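/- Let $g\ge 6$ and let $H=\mathbb{Q}^{2g}$ with basis $e_1,\dots,e_{2g}$; put $i'=2g+1-i$. Let $\langle\cdot,\cdot\rangle$ be the symplectic form on $H$ with $\langle e_i,e_{i'}\rangle=1$ for $i\le g$, $\langle e_i,e_{i'}\rangle=-1$ for $i>g$, and $\langle e_i,e_j\rangle=0$ for $j\ne i'$; let $J$ be its matrix and $\mathrm{Sp}(2g,\mathbb{Q})=\{A : {}^tAJA=J\}$. Put $e_i^*=e_{i'}$ for $i\le g$, $e_i^*=-e_{i'}$ for $i>g$, and $\omega=\sum_{i=1}^{2g}e_i\otimes e_i^*$. The group algebra $\mathbb{Q}[\mathfrak{S}_n]$ acts on $H^{\otimes n}$ from the right by $(a_1\otimes\cdots\otimes a_n)\cdot\tau=a_{\tau(1)}\otimes\cdots\otimes a_{\tau(n)}$. Let $s_i$ be the transposition of $i$ and $i+1$, let $\theta=(1-s_2)(1-s_3s_2)\cdots(1-s_9s_8\cdots s_2)\in\mathbb{Q}[\mathfrak{S}_{10}]$, let $\zeta$ be the cyclic permutation with $(a_1\otimes\cdots\otimes a_{10})\cdot\zeta=a_2\otimes\cdots\otimes a_{10}\otimes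 a_1$, and let $\zeta_{10}=\sum_{i=0}^{9}\zeta^i$. Put $$v_{[3,1^5]}=\omega\otimes\Big(\sum_{\sigma\in\mathfrak{S}_6}\mathrm{sgn}(\sigma)\,e_{\sigma(1)}\otimes\cdots\otimes e_{\sigma(6)}\Big)\otimes e_1\otimes e_1\in H^{\otimes 10}.$$ Let $\mathcal{L}(k)\subset H^{\otimes k}$ be the degree $k$ part of the Lie subalgebra of the tensor algebra generated by $H$ (the free Lie algebra on $H$), and let $\mathfrak{h}_{g,1}(k)\subset H\otimes\mathcal{L}(k+1)\subset H^{\otimes(k+2)}$ be the kernel of the bracket map $H\otimes\mathcal{L}(k+1)\to\mathcal{L}(k+2)$, $X\otimes u\mapsto[X,u]$. Let $\pi=\pi_k:H^{\otimes k}\to\mathcal{C}(k)$ be the quotient of $H^{\otimes k}$ by the span of all $a_1\otimes a_2\otimes\cdots\otimes a_k-a_2\otimes\cdots\otimes a_k\otimes a_1$. For $1\le\ell\le k+1$ let $\Theta_\ell:H^{\otimes(k+2)}\to\mathcal{C}(\ell-1)\otimes\mathcal{C}(k+1-\ell)$ be the linear map $$a_0\otimes a_1\otimes\cdots\otimes a_{k+1}\mapsto\langle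 a_0,a_\ell\rangle\,\pi(a_1\otimes\cdots\otimes a_{\ell-1})\otimes\pi(a_{\ell+1}\otimes\cdots\otimes a_{k+1}),$$ and let $\delta_k^{\mathrm{alg}}:H^{\otimes(k+2)}\to\bigoplus_{p,q\ge1,\ p+q=k}\mathcal{C}(p)\otimes\mathcal{C}(q)$ be the linear map $$a_1\otimes\cdots\otimes a_{k+2}\mapsto\sum_{\substack{1\le i<j\le k+2\\1<j-i<k+1}}\langle a_i,a_j\rangle\big(\pi(A_{ij})\otimes\pi(B_{ij})-\pi(B_{ij})\otimes\pi(A_{ij})\big),$$ where $A_{ij}=a_{i+1}\otimes\cdots\otimes a_{j-1}$ and $B_{ij}=a_{j+1}\otimes\cdots\otimes a_{k+2}\otimes a_1\otimes\cdots\otimes a_{i-1}$. **Theorem.** Let $x=v_{[3,1^5]}\,\theta\,\zeta_{10}$. 1. $x$ lies in $\mathfrak{h}_{g,1}(8)$ and is an $\mathrm{Sp}$-maximal vector of weight $[3,1^5]$: it is nonzero, it is fixed by every upper unitriangular matrix in $\mathrm{Sp}(2g,\mathbb{Q})$, and every diagonal matrix $\mathrm{diag}(d_1,\dots,d_{2g})\in\mathrm{Sp}(2g,\mathbb{Q})$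 multiplies it by $d_1^3d_2d_3d_4d_5d_6$. 2. $\Theta_\ell(x)=0$ for all $2\le\ell\le8$. 3. On $\mathfrak{h}_{g,1}(8)$ one has $\delta_8^{\mathrm{alg}}=10\,(\Theta_2+\cdots+\Theta_8)$; in particular $\delta_8^{\mathrm{alg}}(x)=0$. -/

import Mathlib

open scoped TensorProduct

noncomputable section

namespace JohnsonCokernel

/-! ## The symplectic space -/

/-- `H_ℚ = ℚ^{2g}`. -/
abbrev H (g : ℕ) : Type := Fin (2 * g) → ℚ

/-- The basis vector `e_i` with the numbering `1 ≤ i ≤ 2g` (and `0` for any other `i`). -/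
def e (g i : ℕ) : H g := fun j => if j.val + 1 = i then 1 else 0

/-- The matrix `J` of the symplectic form: `J_{i,i'} = 1` for `i ≤ g`, `J_{i,i'} = -1` for `i > g`,
where `i' = 2g + 1 - i`, and all other entries are zero. -/
def J (g : ℕ) : Matrix (Fin (2 * g)) (Fin (2 * g)) ℚ :=
  fun i j => if j = i.rev then (if i.val < g then 1 else -1) else 0

/-- The symplectic form `⟨x, y⟩ = ᵗx J y`. -/
def form (g : ℕ) : LinearMap.BilinForm ℚ (H g) := Matrix.toBilin' (J g)

/-- `e_i^* = e_{i'}` for `i ≤ g` and `e_i^* = -e_{i'}` for `i > g`, so that `⟨e_i, e_j^*⟩ = δ_{ij}`. -/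
def eStar (g i : ℕ) : H g := if i ≤ g then e g (2 * g + 1 - i) else -e g (2 * g + 1 - i)

/-! ## Place permutations -/

/-- The right action of a permutation on tensors:
`(a_1 ⊗ ⋯ ⊗ a_n) · τ = a_{τ(1)} ⊗ ⋯ ⊗ a_{τ(n)}`. -/
def place (g n : ℕ) (τ : Equiv.Perm (Fin n)) : Module.End ℚ (⨂[ℚ]^n (H g)) :=
  (PiTensorProduct.reindex ℚ (fun _ : Fin n => H g) τ⁻¹).toLinearMap

theorem place_tprod (g n : ℕ) (τ : Equiv.Perm (Fin n)) (a : Fin n → H g) :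
    place g n τ (PiTensorProduct.tprod ℚ a) = PiTensorProduct.tprod ℚ (fun i => a (τ i)) := by
  simp only [place, LinearEquiv.coe_coe]
  erw [PiTensorProduct.reindex_tprod]
  rfl

/-- The right action of the group algebra `ℚ[𝔖_n]` on `H^{⊗ n}`, as an algebra homomorphism to the
opposite of the endomorphism algebra. -/
def placeAlg (g n : ℕ) :
    MonoidAlgebra ℚ (Equiv.Perm (Fin n)) →ₐ[ℚ] (Module.End ℚ (⨂[ℚ]^n (H g)))ᵐᵒᵖ :=
  MonoidAlgebra.lift ℚ _ _
    { toFun := fun τ => MulOpposite.op (place g n τ)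
      map_one' := by
        rw [← MulOpposite.op_one]
        congr 1
        refine PiTensorProduct.ext (MultilinearMap.ext fun a => ?_)
        simp [place_tprod]
      map_mul' := fun σ τ => by
        rw [← MulOpposite.op_mul]
        congr 1
        refine PiTensorProduct.ext (MultilinearMap.ext fun a => ?_)
        simp [place_tprod] }

/-- `v · x` for a tensor `v` and `x ∈ ℚ[𝔖_n]`. -/
def act {g n : ℕ} (v : ⨂[ℚ]^n (H g)) (x : MonoidAlgebra ℚ (Equiv.Perm (Fin n))) :
    ⨂[ℚ]^n (H g) :=
  (placeAlg g n x).unop v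

/-- The cyclic sum `ζ_n = ∑_{i=0}^{n-1} ζ^i`, where
`(a_1 ⊗ ⋯ ⊗ a_n) · ζ = a_2 ⊗ ⋯ ⊗ a_n ⊗ a_1`. -/
def zeta (n : ℕ) : MonoidAlgebra ℚ (Equiv.Perm (Fin n)) :=
  ∑ i ∈ Finset.range n, MonoidAlgebra.of ℚ (Equiv.Perm (Fin n)) (finRotate n ^ i)

/-- `s_i`, the transposition of the places `i` and `i + 1` (places are numbered `1, …, 10`). -/
def s (i : ℕ) : Equiv.Perm (Fin 10) := Equiv.swap (Fin.ofNat 10 (i - 1)) (Fin.ofNat 10 i)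

/-- `sProd m = s_{m+1} s_m ⋯ s_2`. -/
def sProd : ℕ → Equiv.Perm (Fin 10)
  | 0 => 1
  | m + 1 => s (m + 2) * sProd m

/-- `θ = (1 - s_2)(1 - s_3 s_2) ⋯ (1 - s_9 s_8 ⋯ s_2)`. -/
def theta : MonoidAlgebra ℚ (Equiv.Perm (Fin 10)) :=
  ((List.range 8).map fun m =>
    1 - MonoidAlgebra.of ℚ (Equiv.Perm (Fin 10)) (sProd (m + 1))).prod

/-! ## The vector -/

/-- `v_{[3,1^5]} = ω ⊗ (e_1 ∧ ⋯ ∧ e_6) ⊗ e_1 ⊗ e_1`, with `ω = ∑_{r=1}^{2g} e_r ⊗ e_r^*`. -/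
def vHook (g : ℕ) : ⨂[ℚ]^10 (H g) :=
  ∑ r ∈ Finset.Icc 1 (2 * g), ∑ σ : Equiv.Perm (Fin 6),
    ((Equiv.Perm.sign σ : ℤ) : ℚ) • PiTensorProduct.tprod ℚ
      ![e g r, eStar g r,
        e g ((σ 0).val + 1), e g ((σ 1).val + 1), e g ((σ 2).val + 1),
        e g ((σ 3).val + 1), e g ((σ 4).val + 1), e g ((σ 5).val + 1),
        e g 1, e g 1]

/-- `v_{[3,1^5]} θ ζ_{10}`. -/
def vThetaZeta (g : ℕ) : ⨂[ℚ]^10 (H g) := act (act (vHook g) theta) (zeta 10)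

/-! ## Free Lie algebra and `𝔥_{g,1}(k)` -/

attribute [local instance] LieRing.ofAssociativeRing LieAlgebra.ofAssociativeAlgebra

/-- `𝓛_{2g}(k)`, the degree `k` part of the free Lie algebra on `H`, inside `H^{⊗ k}`: the tensors
of degree `k` that lie in the Lie subalgebra of the tensor algebra generated by `H`. -/
def freeLie (g k : ℕ) : Submodule ℚ (⨂[ℚ]^k (H g)) :=
  (LieSubalgebra.lieSpan ℚ (TensorAlgebra ℚ (H g))
    (Set.range (TensorAlgebra.ι ℚ : H g → TensorAlgebra ℚ (H g)))).toSubmodule.comap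
      TensorPower.toTensorAlgebra

/-- The left bracketing `H ⊗ 𝓛(k+1) → 𝓛(k+2)`, `X ⊗ u ↦ [X, u]`, with values viewed in the tensor
algebra, which contains `𝓛(k+2)`. -/
def bracketing (g k : ℕ) : H g ⊗[ℚ] freeLie g (k + 1) →ₗ[ℚ] TensorAlgebra ℚ (H g) :=
  TensorProduct.lift
    (((LieModule.toEnd ℚ (TensorAlgebra ℚ (H g)) (TensorAlgebra ℚ (H g))).toLinearMap ∘ₗ
      TensorAlgebra.ι ℚ).compl₂ (TensorPower.toTensorAlgebra ∘ₗ (freeLie g (k + 1)).subtype))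

/-- The inclusion `H ⊗ 𝓛(k+1) → H^{⊗ (k+2)}`,
`X ⊗ (a_1 ⊗ ⋯ ⊗ a_{k+1}) ↦ X ⊗ a_1 ⊗ ⋯ ⊗ a_{k+1}`. -/
def inclusion (g k : ℕ) : H g ⊗[ℚ] freeLie g (k + 1) →ₗ[ℚ] ⨂[ℚ]^(k + 2) (H g) :=
  TensorProduct.lift
    ((PiTensorProduct.lift.toLinearMap ∘ₗ
      (PiTensorProduct.tprod ℚ : MultilinearMap ℚ (fun _ : Fin (k + 2) => H g) _).curryLeft).compl₂
        (freeLie g (k + 1)).subtype)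

/-- `𝔥_{g,1}(k)` over `ℚ`: the kernel of the left bracketing, viewed inside `H^{⊗ (k+2)}`. -/
def 𝔥 (g k : ℕ) : Submodule ℚ (⨂[ℚ]^(k + 2) (H g)) :=
  (LinearMap.ker (bracketing g k)).map (inclusion g k)

/-! ## Cyclic coinvariants, contractions -/

/-- The relations `a_1 ⊗ a_2 ⊗ ⋯ ⊗ a_k - a_2 ⊗ ⋯ ⊗ a_k ⊗ a_1`. -/
def cyclicRel (g k : ℕ) : Submodule ℚ (⨂[ℚ]^k (H g)) :=
  Submodule.span ℚ (Set.range fun a : Fin k → H g =>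
    PiTensorProduct.tprod ℚ a - PiTensorProduct.tprod ℚ (fun i => a (finRotate k i)))

/-- `𝓒_{2g}(k)`, the coinvariants of `H^{⊗ k}` under cyclic permutations. -/
def C (g k : ℕ) : Type := (⨂[ℚ]^k (H g)) ⧸ cyclicRel g k

instance (g k : ℕ) : AddCommGroup (C g k) :=
  inferInstanceAs (AddCommGroup ((⨂[ℚ]^k (H g)) ⧸ cyclicRel g k))

instance (g k : ℕ) : Module ℚ (C g k) :=
  inferInstanceAs (Module ℚ ((⨂[ℚ]^k (H g)) ⧸ cyclicRel g k))

/-- The projection `π_k : H^{⊗ k} → 𝓒_{2g}(k)`. -/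
def proj (g k : ℕ) : ⨂[ℚ]^k (H g) →ₗ[ℚ] C g k := (cyclicRel g k).mkQ

/-- The places `i`, `j` and `f 0, f 1, …` are distinct and exhaust all `n` places. -/
structure Complementary {n m : ℕ} (i j : Fin n) (f : Fin m → Fin n) : Prop where
  ne : i ≠ j
  inj : Function.Injective f
  ne_left : ∀ t, f t ≠ i
  ne_right : ∀ t, f t ≠ j
  cover : ∀ p, p = i ∨ p = j ∨ ∃ t, f t = p

/-- `(a_p)_p ↦ ⟨a_i, a_j⟩ a_{f 0} ⊗ a_{f 1} ⊗ ⋯`. -/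
def contractMulti (g : ℕ) {n m : ℕ} (i j : Fin n) (f : Fin m → Fin n) (h : Complementary i j f) :
    MultilinearMap ℚ (fun _ : Fin n => H g) (⨂[ℚ]^m (H g)) where
  toFun a := form g (a i) (a j) • PiTensorProduct.tprod ℚ (fun t => a (f t))
  map_update_add' a p x y := by
    rcases h.cover p with rfl | rfl | ⟨t, rfl⟩
    · simp [h.ne.symm, h.ne_left, add_smul]
    · simp [h.ne, h.ne_right, add_smul]
    · have key : ∀ z, (fun u => Function.update a (f t) z (f u)) =
          Function.update (fun u => a (f u)) t z :=
        fun z => Function.update_comp_eq_of_injective a h.inj t z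
      simp [key, (h.ne_left t).symm, (h.ne_right t).symm]
  map_update_smul' a p c x := by
    rcases h.cover p with rfl | rfl | ⟨t, rfl⟩
    · simp [h.ne.symm, h.ne_left, mul_smul]
    · simp [h.ne, h.ne_right, mul_smul]
    · have key : ∀ z, (fun u => Function.update a (f t) z (f u)) =
          Function.update (fun u => a (f u)) t z :=
        fun z => Function.update_comp_eq_of_injective a h.inj t z
      simp [key, (h.ne_left t).symm, (h.ne_right t).symm, smul_comm c]

/-- The contraction of the places `i` and `j`, the remaining places being listed in the order
`f 0, f 1, …`. -/
def contract (g : ℕ) {n m : ℕ} (i j : Fin n) (f : Fin m → Fin n) (h : Complementary i j f) :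
    ⨂[ℚ]^n (H g) →ₗ[ℚ] ⨂[ℚ]^m (H g) :=
  PiTensorProduct.lift (contractMulti g i j f h)

/-- For `p + q = k`, the map `H^{⊗ k} → 𝓒(p) ⊗ 𝓒(q)`,
`a_1 ⊗ ⋯ ⊗ a_k ↦ π_p(a_1 ⊗ ⋯ ⊗ a_p) ⊗ π_q(a_{p+1} ⊗ ⋯ ⊗ a_k)`. -/
def varpi (g : ℕ) {k p q : ℕ} (h : p + q = k) : ⨂[ℚ]^k (H g) →ₗ[ℚ] C g p ⊗[ℚ] C g q :=
  TensorProduct.map (proj g p) (proj g q) ∘ₗ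
    (TensorPower.mulEquiv (R := ℚ) (M := H g) (n := p) (m := q)).symm.toLinearMap ∘ₗ
      (TensorPower.cast ℚ (H g) h.symm).toLinearMap

theorem complementary_succAbove {k : ℕ} (l : Fin (k + 1)) :
    Complementary (0 : Fin (k + 2)) l.succ (fun t : Fin k => (l.succAbove t).succ) where
  ne := (Fin.succ_ne_zero l).symm
  inj := fun _ _ h => Fin.succAbove_right_injective (Fin.succ_injective _ h)
  ne_left := fun _ => Fin.succ_ne_zero _
  ne_right := fun t h => Fin.succAbove_ne l t (Fin.succ_injective _ h)
  cover := fun p => by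
    rcases Fin.eq_zero_or_eq_succ p with rfl | ⟨p', rfl⟩
    · exact Or.inl rfl
    · rcases eq_or_ne p' l with rfl | hp
      · exact Or.inr (Or.inl rfl)
      · obtain ⟨t, ht⟩ := Fin.exists_succAbove_eq hp
        exact Or.inr (Or.inr ⟨t, by rw [ht]⟩)

/-- The contraction `Φ_{1,ℓ+1} : H^{⊗ (k+2)} → H^{⊗ k}` for `1 ≤ ℓ ≤ k + 1`, the first factor `H`
being identified with `H^*` by `x ↦ ⟨x, •⟩`:
`a_0 ⊗ a_1 ⊗ ⋯ ⊗ a_{k+1} ↦ ⟨a_0, a_ℓ⟩ a_1 ⊗ ⋯ ⊗ a_{ℓ-1} ⊗ a_{ℓ+1} ⊗ ⋯ ⊗ a_{k+1}`. -/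
def Phi (g k l : ℕ) (h1 : 1 ≤ l) (h2 : l ≤ k + 1) : ⨂[ℚ]^(k + 2) (H g) →ₗ[ℚ] ⨂[ℚ]^k (H g) :=
  contract g 0 (Fin.succ ⟨l - 1, by omega⟩) _ (complementary_succAbove ⟨l - 1, by omega⟩)

/-- `Θ_ℓ = ϖ_ℓ ∘ Φ_{1,ℓ+1} : H^{⊗ (k+2)} → 𝓒(ℓ-1) ⊗ 𝓒(k-ℓ+1)` for `1 ≤ ℓ ≤ k + 1`. -/
def Theta (g k l : ℕ) (h1 : 1 ≤ l) (h2 : l ≤ k + 1) :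
    ⨂[ℚ]^(k + 2) (H g) →ₗ[ℚ] C g (l - 1) ⊗[ℚ] C g (k + 1 - l) :=
  varpi g (by omega) ∘ₗ Phi g k l h1 h2

/-! ## The map `δ_k^alg` -/

/-- Pairs `(p, q)` with `p, q ≥ 1` and `p + q = k`. -/
abbrev Splitting (k : ℕ) : Type := {s : ℕ × ℕ // 1 ≤ s.1 ∧ 1 ≤ s.2 ∧ s.1 + s.2 = k}

/-- `⨁_{p,q ≥ 1, p+q=k} 𝓒(p) ⊗ 𝓒(q)`. -/
abbrev CC (g k : ℕ) : Type :=
  DirectSum (Splitting k) fun s => C g s.1.1 ⊗[ℚ] C g s.1.2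

/-- The inclusion of the summand `𝓒(p) ⊗ 𝓒(q)`. -/
def inCC (g : ℕ) {k p q : ℕ} (h : 1 ≤ p ∧ 1 ≤ q ∧ p + q = k) :
    C g p ⊗[ℚ] C g q →ₗ[ℚ] CC g k :=
  DirectSum.lof ℚ (Splitting k) (fun s => C g s.1.1 ⊗[ℚ] C g s.1.2) ⟨(p, q), h⟩

/-- `Θ_2 + ⋯ + Θ_k`, with values in the direct sum. -/
def ThetaSum (g k : ℕ) : ⨂[ℚ]^(k + 2) (H g) →ₗ[ℚ] CC g k :=
  ∑ l ∈ Finset.range (k + 1), if h : 2 ≤ l ∧ l ≤ k then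
    inCC g (p := l - 1) (q := k + 1 - l) (by omega) ∘ₗ Theta g k l (by omega) (by omega) else 0

/-- For places `i < j` among `0, …, k+1`, the remaining places in the order
`i+1, …, j-1, j+1, …, k+1, 0, …, i-1`. -/
def arcs {k : ℕ} (i j : Fin (k + 2)) (hij : i < j) (t : Fin k) : Fin (k + 2) :=
  if h : i.val + 1 + t.val < j.val then ⟨i.val + 1 + t.val, by omega⟩
  else if h' : i.val + 2 + t.val < k + 2 then ⟨i.val + 2 + t.val, h'⟩
  else ⟨i.val + 2 + t.val - (k + 2), by omega⟩

theorem complementary_arcs {k : ℕ} (i j : Fin (k + 2)) (hij : i < j) :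
    Complementary i j (arcs i j hij) where
  ne := ne_of_lt hij
  inj := fun t u h => by
    rw [Fin.ext_iff] at h ⊢
    rw [Fin.lt_def] at hij
    unfold arcs at h
    split_ifs at h <;> simp only at h <;> omega
  ne_left := fun t h => by
    rw [Fin.ext_iff] at h
    rw [Fin.lt_def] at hij
    unfold arcs at h
    split_ifs at h <;> simp only at h <;> omega
  ne_right := fun t h => by
    rw [Fin.ext_iff] at h
    rw [Fin.lt_def] at hij
    unfold arcs at h
    split_ifs at h <;> simp only at h <;> omega
  cover := fun p => by
    by_cases hi : p = i
    · exact Or.inl hi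
    by_cases hj : p = j
    · exact Or.inr (Or.inl hj)
    refine Or.inr (Or.inr ?_)
    rw [Fin.ext_iff] at hi hj
    have hl : i.val < j.val := hij
    rcases lt_or_ge p.val i.val with h1 | h1
    · refine ⟨⟨p.val + k - i.val, by omega⟩, ?_⟩
      rw [Fin.ext_iff]
      simp only [arcs]
      split_ifs <;> simp only <;> omega
    · rcases lt_or_ge p.val j.val with h2 | h2
      · refine ⟨⟨p.val - i.val - 1, by omega⟩, ?_⟩
        rw [Fin.ext_iff]
        simp only [arcs]
        split_ifs <;> simp only <;> omega
      · refine ⟨⟨p.val - i.val - 2, by omega⟩, ?_⟩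
        rw [Fin.ext_iff]
        simp only [arcs]
        split_ifs <;> simp only <;> omega

/-- `δ_k^alg`: the map sending `a_1 ⊗ ⋯ ⊗ a_{k+2}` to the sum, over `i < j` with `1 < j - i < k + 1`,
of `⟨a_i, a_j⟩ (π(A) ⊗ π(B) - π(B) ⊗ π(A))`, where `A = a_{i+1} ⊗ ⋯ ⊗ a_{j-1}` and
`B = a_{j+1} ⊗ ⋯ ⊗ a_{k+2} ⊗ a_1 ⊗ ⋯ ⊗ a_{i-1}`. -/
def deltaAlg (g k : ℕ) : ⨂[ℚ]^(k + 2) (H g) →ₗ[ℚ] CC g k :=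
  ∑ i : Fin (k + 2), ∑ j : Fin (k + 2),
    if h : i < j ∧ 1 < j.val - i.val ∧ j.val - i.val < k + 1 then
      (inCC g (k := k) (p := j.val - i.val - 1) (q := k + 1 - (j.val - i.val)) (by omega) -
        inCC g (k := k) (p := k + 1 - (j.val - i.val)) (q := j.val - i.val - 1) (by omega) ∘ₗ
          (TensorProduct.comm ℚ (C g (j.val - i.val - 1))
            (C g (k + 1 - (j.val - i.val)))).toLinearMap) ∘ₗ
        varpi g (p := j.val - i.val - 1) (q := k + 1 - (j.val - i.val)) (by omega) ∘ₗ
          contract g i j (arcs i j h.1) (complementary_arcs i j h.1)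
    else 0

/-! ## Maximal vectors -/

/-- The diagonal action of a matrix on `H^{⊗ n}`. -/
def matAct (g n : ℕ) (A : Matrix (Fin (2 * g)) (Fin (2 * g)) ℚ) : Module.End ℚ (⨂[ℚ]^n (H g)) :=
  PiTensorProduct.map (fun _ => Matrix.toLin' A)

/-- `v` is an `Sp`-maximal vector of weight `lam = (lam_1, …, lam_g)`: it is nonzero, it is fixed by
all upper unitriangular matrices of `Sp(2g, ℚ) = {A | ᵗA J A = J}`, and the diagonal matrices of
`Sp(2g, ℚ)`, those with diagonal entries `d_i` such that `d_i d_{i'} = 1`, act on it by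
`∏_{i=1}^g d_i ^ lam_i`. The parts of `lam` are given as a list, missing parts being zero. -/
structure IsSpMaximal (g : ℕ) {n : ℕ} (lam : List ℕ) (v : ⨂[ℚ]^n (H g)) : Prop where
  ne_zero : v ≠ 0
  unipotent : ∀ A : Matrix (Fin (2 * g)) (Fin (2 * g)) ℚ, A.transpose * J g * A = J g →
    A.BlockTriangular id → (∀ i, A i i = 1) → matAct g n A v = v
  torus : ∀ d : Fin (2 * g) → ℚ, (∀ i, d i * d i.rev = 1) →
    matAct g n (Matrix.diagonal d) v =
      (∏ i : Fin (2 * g), if i.val < g then d i ^ lam.getD i.val 0 else 1) • v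

end JohnsonCokernel

end

open scoped TensorProduct
open TensorPower (toTensorAlgebra)

noncomputable section

namespace JohnsonCokernel

section FreeLie

attribute [local instance] LieRing.ofAssociativeRing LieAlgebra.ofAssociativeAlgebra

/-! ## The action of the group algebra -/

section Act

variable {g n : ℕ}

/-! Membership. The successive factors of `theta` build a left-normed bracket, so `theta` sends X ⊗
b ⊗ b_1 ⊗ ⋯ ⊗ b_8 to X ⊗ [⋯[b, b_1], …, b_8] (`toTensorAlgebra_act_theta`). Since [X, u] = Xu - uX
is a tensor minus its rotation, 𝔥(k) consists of the rotation-invariant elements of H ⊗ 𝓛(k+1). A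
cyclic sum is invariant, and it stays in H ⊗ 𝓛(k+1) because letters can be moved one at a time from
one bracket to another (`cycSum_bracketList_mem`).

Maximality. Matrices commute with place permutations, so only `vHook` matters: ω is Sp-invariant,
and an upper triangular matrix scales e_1 ∧ ⋯ ∧ e_6 and e_1 by diagonal entries (`matAct_vHook`).

The map δ. On an invariant tensor, the two terms of δ at i < j are Θ_d and Θ_{10-d} with d = j - i,
by rotating i or j to the front and using antisymmetry of the form. There are 10 - d pairs at
difference d and d pairs at difference 10 - d, so each Θ_d occurs 10 times
(`deltaAlg_eq_of_invariant`).

Vanishing and nonvanishing. The vector is encoded by integral combinations of words whose letters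
stand for the two factors of ω, the six wedge factors and e_1; signs under exchange of wedge letters
allow words to be sorted and collected, uniformly in g. Contracting ω with itself gives 2g,
contracting one factor with y puts ±y in place of the other, and e_1, …, e_6 are mutually orthogonal
because g ≥ 6 (`Theta_hookWord`). The loop and cross parts each vanish after averaging over
rotations, a finite computation, so Θ_ℓ vanishes for every such g. For `vThetaZeta_ne_zero`, the
first place is paired with e_6 and one coordinate of the result is shown to be 1. -/

theorem act_mul (v : ⨂[ℚ]^n (H g)) (x y : MonoidAlgebra ℚ (Equiv.Perm (Fin n))) :
    act v (x * y) = act (act v x) y := by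
  simp [act]

theorem act_one (v : ⨂[ℚ]^n (H g)) : act v 1 = v := by
  simp [act]

theorem act_sub (v : ⨂[ℚ]^n (H g)) (x y : MonoidAlgebra ℚ (Equiv.Perm (Fin n))) :
    act v (x - y) = act v x - act v y := by
  simp [act]

theorem act_sum {ι : Type*} (s : Finset ι) (v : ⨂[ℚ]^n (H g))
    (x : ι → MonoidAlgebra ℚ (Equiv.Perm (Fin n))) :
    act v (∑ i ∈ s, x i) = ∑ i ∈ s, act v (x i) := by
  simp [act, Finset.unop_sum, LinearMap.sum_apply]

theorem act_of (v : ⨂[ℚ]^n (H g)) (τ : Equiv.Perm (Fin n)) :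
    act v (MonoidAlgebra.of ℚ _ τ) = place g n τ v := by
  simp [act, placeAlg, MonoidAlgebra.lift_single]

theorem act_eq (v : ⨂[ℚ]^n (H g)) (x : MonoidAlgebra ℚ (Equiv.Perm (Fin n))) :
    act v x = (placeAlg g n x).unop v := rfl

theorem act_zeta (v : ⨂[ℚ]^n (H g)) :
    act v (zeta n) = ∑ i ∈ Finset.range n, place g n (finRotate n ^ i) v := by
  simp only [zeta, act_sum, act_of]

theorem place_mul_apply (σ τ : Equiv.Perm (Fin n)) (v : ⨂[ℚ]^n (H g)) :
    place g n (σ * τ) v = place g n τ (place g n σ v) := by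
  rw [← act_of, ← act_of, ← act_of, map_mul, act_mul]

theorem matAct_place (A : Matrix (Fin (2 * g)) (Fin (2 * g)) ℚ) (τ : Equiv.Perm (Fin n))
    (v : ⨂[ℚ]^n (H g)) : matAct g n A (place g n τ v) = place g n τ (matAct g n A v) := by
  have : matAct g n A ∘ₗ place g n τ = place g n τ ∘ₗ matAct g n A := by
    refine PiTensorProduct.ext (MultilinearMap.ext fun a => ?_)
    simp [matAct, place_tprod, PiTensorProduct.map_tprod]
  exact LinearMap.congr_fun this v

theorem matAct_act (A : Matrix (Fin (2 * g)) (Fin (2 * g)) ℚ)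
    (v : ⨂[ℚ]^n (H g)) (x : MonoidAlgebra ℚ (Equiv.Perm (Fin n))) :
    matAct g n A (act v x) = act (matAct g n A v) x := by
  induction x using MonoidAlgebra.induction_on with
  | of τ => simp only [act_of, matAct_place]
  | add x y hx hy =>
    simp only [act_eq, map_add, MulOpposite.unop_add, LinearMap.add_apply] at *
    rw [hx, hy]
  | smul c x hx =>
    simp only [act_eq, map_smul, MulOpposite.unop_smul, LinearMap.smul_apply] at *
    rw [hx]

end Act

/-! ## Tensor powers inside the tensor algebra -/

section Tensor

variable {g n : ℕ}

/-- Followed by the map to the direct sum of tensor powers, this becomes the inclusion of one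
summand. Identities of tensors may therefore be checked as identities of noncommutative polynomials.
-/
theorem toTensorAlgebra_injective :
    Function.Injective (toTensorAlgebra : ⨂[ℚ]^n (H g) →ₗ[ℚ] TensorAlgebra ℚ (H g)) := by
  have h : ∀ v : ⨂[ℚ]^n (H g), TensorAlgebra.toDirectSum (toTensorAlgebra v) =
      DirectSum.lof ℚ ℕ (fun n => ⨂[ℚ]^n (H g)) n v := fun v => by
    have : TensorAlgebra.toDirectSum.toLinearMap ∘ₗ toTensorAlgebra =
        DirectSum.lof ℚ ℕ (fun n => ⨂[ℚ]^n (H g)) n := by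
      refine PiTensorProduct.ext (MultilinearMap.ext fun a => ?_)
      simp only [LinearMap.compMultilinearMap_apply, LinearMap.comp_apply,
        TensorPower.toTensorAlgebra_tprod, AlgHom.toLinearMap_apply,
        TensorAlgebra.toDirectSum_tensorPower_tprod]
      rfl
    exact LinearMap.congr_fun this v
  intro v w hvw
  have := h v
  rw [hvw, h w] at this
  exact (DirectSum.of_injective n this).symm

theorem toTensorAlgebra_tprod_eq_prod (a : Fin n → H g) :
    toTensorAlgebra (PiTensorProduct.tprod ℚ a) =
      (List.ofFn fun i => TensorAlgebra.ι ℚ (a i)).prod := by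
  rw [TensorPower.toTensorAlgebra_tprod, TensorAlgebra.tprod_apply]

theorem toTensorAlgebra_matAct (A : Matrix (Fin (2 * g)) (Fin (2 * g)) ℚ) (v : ⨂[ℚ]^n (H g)) :
    toTensorAlgebra (matAct g n A v) =
      TensorAlgebra.lift ℚ (TensorAlgebra.ι ℚ ∘ₗ Matrix.toLin' A) (toTensorAlgebra v) := by
  have : toTensorAlgebra ∘ₗ matAct g n A =
      (TensorAlgebra.lift ℚ (TensorAlgebra.ι ℚ ∘ₗ Matrix.toLin' A)).toLinearMap ∘ₗ
        toTensorAlgebra := by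
    refine PiTensorProduct.ext (MultilinearMap.ext fun a => ?_)
    simp only [LinearMap.compMultilinearMap_apply, LinearMap.comp_apply, matAct,
      PiTensorProduct.map_tprod, toTensorAlgebra_tprod_eq_prod, AlgHom.toLinearMap_apply,
      map_list_prod, List.map_ofFn]
    congr 2
    ext i
    simp
  exact LinearMap.congr_fun this v

end Tensor

/-! ## Cyclic invariance of `𝔥_{g,1}(k)` -/

section Cyclic

variable {g : ℕ}

theorem prod_ofFn_rotate {A : Type*} [Monoid A] {n : ℕ} (a : Fin (n + 1) → A) :
    (List.ofFn fun i => a (finRotate (n + 1) i)).prod =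
      (List.ofFn fun i : Fin n => a i.succ).prod * a 0 := by
  rw [List.ofFn_succ', List.concat_eq_append, List.prod_append]
  simp only [finRotate_apply, Fin.coeSucc_eq_succ, Fin.last_add_one, List.prod_singleton]

theorem inclusion_tmul (k : ℕ) (X : H g) (u : freeLie g (k + 1)) :
    toTensorAlgebra (inclusion g k (X ⊗ₜ u)) =
      TensorAlgebra.ι ℚ X * toTensorAlgebra (u : ⨂[ℚ]^(k + 1) (H g)) := by
  have : toTensorAlgebra ∘ₗ (PiTensorProduct.lift.toLinearMap ∘ₗ
      (PiTensorProduct.tprod ℚ : MultilinearMap ℚ (fun _ : Fin (k + 2) => H g) _).curryLeft) X =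
      LinearMap.mulLeft ℚ (TensorAlgebra.ι ℚ X) ∘ₗ toTensorAlgebra := by
    refine PiTensorProduct.ext (MultilinearMap.ext fun a => ?_)
    simp [toTensorAlgebra_tprod_eq_prod, List.ofFn_succ, -TensorPower.toTensorAlgebra_tprod]
  exact LinearMap.congr_fun this (u : ⨂[ℚ]^(k + 1) (H g))

theorem rotate_inclusion_tmul (k : ℕ) (X : H g) (u : freeLie g (k + 1)) :
    toTensorAlgebra (place g (k + 2) (finRotate (k + 2)) (inclusion g k (X ⊗ₜ u))) =
      toTensorAlgebra (u : ⨂[ℚ]^(k + 1) (H g)) * TensorAlgebra.ι ℚ X := by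
  have : toTensorAlgebra ∘ₗ place g (k + 2) (finRotate (k + 2)) ∘ₗ
      (PiTensorProduct.lift.toLinearMap ∘ₗ
      (PiTensorProduct.tprod ℚ : MultilinearMap ℚ (fun _ : Fin (k + 2) => H g) _).curryLeft) X =
      LinearMap.mulRight ℚ (TensorAlgebra.ι ℚ X) ∘ₗ toTensorAlgebra := by
    refine PiTensorProduct.ext (MultilinearMap.ext fun a => ?_)
    simp only [LinearMap.compMultilinearMap_apply, LinearMap.comp_apply, LinearEquiv.coe_coe,
      PiTensorProduct.lift.tprod, MultilinearMap.curryLeft_apply, place_tprod,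
      toTensorAlgebra_tprod_eq_prod, LinearMap.mulRight_apply]
    rw [prod_ofFn_rotate (fun i => TensorAlgebra.ι ℚ (Fin.cons (α := fun _ => H g) X a i))]
    simp
  exact LinearMap.congr_fun this (u : ⨂[ℚ]^(k + 1) (H g))

/-- The bracketing is the difference of a tensor and its cyclic rotation. -/
theorem bracketing_eq (k : ℕ) (t : H g ⊗[ℚ] freeLie g (k + 1)) :
    bracketing g k t = toTensorAlgebra (inclusion g k t) -
      toTensorAlgebra (place g (k + 2) (finRotate (k + 2)) (inclusion g k t)) := by
  induction t with
  | zero => simp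
  | add x y hx hy => simp only [map_add, hx, hy]; abel
  | tmul X u =>
    rw [inclusion_tmul, rotate_inclusion_tmul]
    simp [bracketing, LieRing.of_associative_ring_bracket]

/-- By `bracketing_eq` the kernel of the bracket is the rotation-invariant part of H ⊗ 𝓛(k+1); this
lemma and the next are the two inclusions. -/
theorem rotate_eq_of_mem {k : ℕ} {x : ⨂[ℚ]^(k + 2) (H g)} (hx : x ∈ 𝔥 g k) :
    place g (k + 2) (finRotate (k + 2)) x = x := by
  obtain ⟨t, ht, rfl⟩ := hx
  have h : bracketing g k t = 0 := ht
  rw [bracketing_eq, sub_eq_zero] at h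
  exact (toTensorAlgebra_injective h).symm

theorem mem_of_rotate_eq {k : ℕ} {x : ⨂[ℚ]^(k + 2) (H g)}
    (hx : x ∈ LinearMap.range (inclusion g k))
    (hr : place g (k + 2) (finRotate (k + 2)) x = x) : x ∈ 𝔥 g k := by
  obtain ⟨t, rfl⟩ := hx
  refine ⟨t, ?_, rfl⟩
  change bracketing g k t = 0
  rw [bracketing_eq, hr, sub_self]

theorem val_finRotate_pow {n : ℕ} (m : ℕ) (i : Fin n) :
    ((finRotate n ^ m) i).val = (i.val + m) % n := by
  induction m with
  | zero => simp [Nat.mod_eq_of_lt i.isLt]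
  | succ m ih =>
    obtain ⟨n, rfl⟩ : ∃ n', n = n' + 1 := ⟨n - 1, by have := i.isLt; omega⟩
    rw [pow_succ', Equiv.Perm.mul_apply, finRotate_apply, Fin.val_add, ih, Fin.val_one']
    simp [add_assoc]

theorem finRotate_pow_self (n : ℕ) : finRotate n ^ n = 1 := by
  ext i
  simp [val_finRotate_pow, Nat.mod_eq_of_lt i.isLt]

theorem rotate_act_zeta {n : ℕ} (v : ⨂[ℚ]^n (H g)) :
    place g n (finRotate n) (act v (zeta n)) = act v (zeta n) := by
  rw [act_zeta, map_sum]
  simp_rw [← place_mul_apply, ← pow_succ]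
  -- The sum over n + 1 powers is split at its last and at its first term; these agree because the
  -- n-th power of the rotation is 1.
  have h := Finset.sum_range_succ (fun i => place g n (finRotate n ^ i) v) n
  rw [Finset.sum_range_succ', finRotate_pow_self, pow_zero] at h
  exact add_right_cancel h

end Cyclic

/-! ## Cyclic sums of products in the tensor algebra -/

section CyclicSum

variable {g : ℕ}

/-- Abbreviation for the tensor algebra of `H`. -/
abbrev TA (g : ℕ) : Type := TensorAlgebra ℚ (H g)

/-- An auxiliary representation of the tensor algebra, from which `cycSum` is extracted. -/
def cycRep (g : ℕ) : TA g →ₐ[ℚ] Module.End ℚ ((TA g →ₗ[ℚ] TA g) × TA g) :=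
  TensorAlgebra.lift ℚ
    { toFun := fun X =>
        -- A product is read from right to left. The second component records what has been read;
        -- the first accumulates, for each letter, left multiplication by the rotation starting at
        -- that letter, precomposed with right multiplication by the letters read later. The
        -- universal property thus extends cyclic sums from words to all tensors.
        { toFun := fun p => (p.1 ∘ₗ LinearMap.mulRight ℚ (TensorAlgebra.ι ℚ X) +
            LinearMap.mulLeft ℚ (TensorAlgebra.ι ℚ X * p.2), TensorAlgebra.ι ℚ X * p.2)
          map_add' := fun p q => by
            ext <;> simp [mul_add, add_mul, mul_assoc]; abel
          map_smul' := fun c p => by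
            ext <;> simp [mul_assoc] }
      map_add' := fun X Y => by
        ext <;> simp [add_mul, mul_add, mul_assoc]
      map_smul' := fun c X => by
        ext <;> simp [mul_assoc] }

/-- `cycSum P Q` is the sum of the cyclic rotations of the product `P * Q` that start with a letter
of `P`. -/
def cycSum (P : TA g) : TA g →ₗ[ℚ] TA g := (cycRep g P (0, 1)).1

theorem cycRep_ι (X : H g) (f : TA g →ₗ[ℚ] TA g) (Q : TA g) :
    cycRep g (TensorAlgebra.ι ℚ X) (f, Q) =
      (f ∘ₗ LinearMap.mulRight ℚ (TensorAlgebra.ι ℚ X) +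
        LinearMap.mulLeft ℚ (TensorAlgebra.ι ℚ X * Q), TensorAlgebra.ι ℚ X * Q) := by
  simp [cycRep]

/-- The general pair (f, Q) is needed in the induction: for a product, the second factor to act
meets the pair left by the first. -/
theorem cycRep_apply (P : TA g) : ∀ (f : TA g →ₗ[ℚ] TA g) (Q : TA g),
    cycRep g P (f, Q) =
      (f ∘ₗ LinearMap.mulRight ℚ P + cycSum P ∘ₗ LinearMap.mulLeft ℚ Q, P * Q) := by
  induction P using TensorAlgebra.induction with
  | algebraMap r =>
    intro f Q
    ext <;> simp [cycSum, Algebra.algebraMap_eq_smul_one]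
  | ι X =>
    intro f Q
    ext <;> simp [cycSum, cycRep_ι]
  | add P P' h h' =>
    intro f Q
    have e : cycSum (P + P') = cycSum P + cycSum P' := by simp [cycSum]
    rw [map_add, LinearMap.add_apply, h, h', e]
    ext <;> simp [add_mul, mul_add]; abel
  | mul P P' h h' =>
    intro f Q
    have e : cycSum (P * P') =
        cycSum P' ∘ₗ LinearMap.mulRight ℚ P + cycSum P ∘ₗ LinearMap.mulLeft ℚ P' := by
      change (cycRep g (P * P') (0, 1)).1 = _
      rw [map_mul, Module.End.mul_apply, h', h]
      ext
      simp
    rw [map_mul, Module.End.mul_apply, h', h, e]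
    ext <;> simp [mul_assoc]; abel

theorem cycSum_ι (X : H g) (Q : TA g) :
    cycSum (TensorAlgebra.ι ℚ X) Q = TensorAlgebra.ι ℚ X * Q := by
  simp [cycSum, cycRep_ι]

/-- A rotation of P P' Q that starts in P P' starts either in P, followed by P' Q, or in P',
followed by Q P. -/
theorem cycSum_mul (P P' Q : TA g) :
    cycSum (P * P') Q = cycSum P (P' * Q) + cycSum P' (Q * P) := by
  change (cycRep g (P * P') (0, 1)).1 Q = _
  rw [map_mul, Module.End.mul_apply, cycRep_apply, cycRep_apply]
  simp [add_comm]

theorem cycSum_one (Q : TA g) : cycSum (1 : TA g) Q = 0 := by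
  simp [cycSum]

theorem cycSum_sub (P P' Q : TA g) : cycSum (P - P') Q = cycSum P Q - cycSum P' Q := by
  simp [cycSum]

theorem cycSum_list_prod (l : List (H g)) : ∀ Q : TA g,
    cycSum (l.map (TensorAlgebra.ι ℚ)).prod Q = ∑ i ∈ Finset.range l.length,
      ((l.drop i).map (TensorAlgebra.ι ℚ)).prod * Q *
        ((l.take i).map (TensorAlgebra.ι ℚ)).prod := by
  induction l with
  | nil => intro Q; simp [cycSum_one]
  | cons x l ih =>
    intro Q
    rw [List.map_cons, List.prod_cons, cycSum_mul, cycSum_ι, ih, List.length_cons,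
      Finset.sum_range_succ']
    simp [mul_assoc, add_comm]

theorem ofFn_finRotate_pow {α : Type*} {n : ℕ} (a : Fin n → α) (m : ℕ) :
    (List.ofFn fun i => a ((finRotate n ^ m) i)) = (List.ofFn a).rotate m := by
  refine List.ext_getElem (by simp) fun i h₁ h₂ => ?_
  rw [List.getElem_rotate]
  simp only [List.getElem_ofFn, List.length_ofFn]
  congr 1
  ext
  rw [val_finRotate_pow]

/-- With second argument 1, every rotation of a word starts inside the word, so `cycSum` gives the
full cyclic sum. -/
theorem toTensorAlgebra_act_zeta {n : ℕ} (v : ⨂[ℚ]^n (H g)) :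
    toTensorAlgebra (act v (zeta n)) = cycSum (toTensorAlgebra v) 1 := by
  -- The cyclic sum is written as a composite of linear maps so that pure tensors suffice.
  have h : toTensorAlgebra ∘ₗ (placeAlg g n (zeta n)).unop =
      (LinearMap.applyₗ (1 : TA g) ∘ₗ LinearMap.fst ℚ _ _ ∘ₗ
        LinearMap.applyₗ ((0, 1) : (TA g →ₗ[ℚ] TA g) × TA g) ∘ₗ (cycRep g).toLinearMap) ∘ₗ
          toTensorAlgebra := by
    refine PiTensorProduct.ext (MultilinearMap.ext fun a => ?_)
    change toTensorAlgebra (act (PiTensorProduct.tprod ℚ a) (zeta n)) =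
      cycSum (toTensorAlgebra (PiTensorProduct.tprod ℚ a)) 1
    have e : ∀ b : Fin n → H g, toTensorAlgebra (PiTensorProduct.tprod ℚ b) =
        ((List.ofFn b).map (TensorAlgebra.ι ℚ)).prod := fun b => by
      rw [toTensorAlgebra_tprod_eq_prod, List.map_ofFn]; rfl
    rw [act_zeta, map_sum, e, cycSum_list_prod, List.length_ofFn]
    refine Finset.sum_congr rfl fun i hi => ?_
    rw [place_tprod, e, ofFn_finRotate_pow, List.rotate_eq_drop_append_take
      (by simpa using (Finset.mem_range.1 hi).le), List.map_append, List.prod_append, mul_one]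
  exact LinearMap.congr_fun h v

end CyclicSum

/-! ## Left-normed brackets -/

section LeftNormed

variable {g : ℕ}

/-- The Lie elements of degree `k` in the tensor algebra. -/
def lieDeg (g k : ℕ) : Submodule ℚ (TA g) := (freeLie g k).map toTensorAlgebra

theorem mem_lieDeg {k : ℕ} {v : TA g} : v ∈ lieDeg g k ↔
    v ∈ LinearMap.range (toTensorAlgebra : ⨂[ℚ]^k (H g) →ₗ[ℚ] TA g) ∧
    v ∈ LieSubalgebra.lieSpan ℚ (TA g) (Set.range (TensorAlgebra.ι ℚ : H g → TA g)) := by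
  constructor
  · rintro ⟨u, hu, rfl⟩
    exact ⟨⟨u, rfl⟩, hu⟩
  · rintro ⟨⟨u, rfl⟩, hu⟩
    exact ⟨u, hu, rfl⟩

theorem ι_mem_lieDeg (X : H g) : TensorAlgebra.ι ℚ X ∈ lieDeg g 1 := by
  refine mem_lieDeg.2 ⟨⟨PiTensorProduct.tprod ℚ fun _ => X, ?_⟩,
    LieSubalgebra.subset_lieSpan ⟨X, rfl⟩⟩
  simp [TensorAlgebra.tprod_apply]

theorem mul_mem_range {i j : ℕ} {v w : TA g}
    (hv : v ∈ LinearMap.range (toTensorAlgebra : ⨂[ℚ]^i (H g) →ₗ[ℚ] TA g))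
    (hw : w ∈ LinearMap.range (toTensorAlgebra : ⨂[ℚ]^j (H g) →ₗ[ℚ] TA g)) :
    v * w ∈ LinearMap.range (toTensorAlgebra : ⨂[ℚ]^(i + j) (H g) →ₗ[ℚ] TA g) := by
  obtain ⟨v, rfl⟩ := hv
  obtain ⟨w, rfl⟩ := hw
  exact ⟨_, TensorPower.toTensorAlgebra_gMul v w⟩

theorem bracket_mem_lieDeg {i j : ℕ} {v w : TA g} (hv : v ∈ lieDeg g i) (hw : w ∈ lieDeg g j) :
    v * w - w * v ∈ lieDeg g (i + j) := by
  rw [mem_lieDeg] at *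
  refine ⟨Submodule.sub_mem _ (mul_mem_range hv.1 hw.1) ?_, ?_⟩
  · rw [add_comm]
    exact mul_mem_range hw.1 hv.1
  · exact LieSubalgebra.lie_mem _ hv.2 hw.2

/-- The image of `H ⊗ 𝓛(k+1)` in the tensor algebra. -/
def inclRange (g k : ℕ) : Submodule ℚ (TA g) :=
  (LinearMap.range (inclusion g k)).map toTensorAlgebra

theorem ι_mul_mem_inclRange {k : ℕ} (X : H g) {v : TA g} (hv : v ∈ lieDeg g (k + 1)) :
    TensorAlgebra.ι ℚ X * v ∈ inclRange g k := by
  obtain ⟨u, hu, rfl⟩ := hv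
  exact ⟨_, ⟨X ⊗ₜ ⟨u, hu⟩, rfl⟩, inclusion_tmul k X ⟨u, hu⟩⟩

/-- The bracketing `[⋯[[P, b_1], b_2], …, b_m]`. -/
def bracketList (P : TA g) (l : List (H g)) : TA g :=
  l.foldl (fun P b => P * TensorAlgebra.ι ℚ b - TensorAlgebra.ι ℚ b * P) P

theorem bracketList_append_singleton (P : TA g) (l : List (H g)) (c : H g) :
    bracketList P (l ++ [c]) = bracketList P l * TensorAlgebra.ι ℚ c -
      TensorAlgebra.ι ℚ c * bracketList P l := by
  simp [bracketList]

theorem bracketList_mem_lieDeg (b : H g) (l : List (H g)) :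
    bracketList (TensorAlgebra.ι ℚ b) l ∈ lieDeg g (l.length + 1) := by
  induction l using List.reverseRecOn with
  | nil => exact ι_mem_lieDeg b
  | append_singleton l c ih =>
    rw [bracketList_append_singleton]
    simpa using bracket_mem_lieDeg ih (ι_mem_lieDeg c)

/-- The outermost letter c of the bracket is passed to Q: cycSum([P, c], Q) = cycSum(P, [c, Q]) + c
[Q, P]. The last term is a letter times a Lie element, and [c, Q] is again Lie, so the induction
shortens the bracket while Q varies. -/
theorem cycSum_bracketList_mem {k : ℕ} (b : H g) (l : List (H g)) : ∀ (q : ℕ) (Q : TA g),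
    Q ∈ lieDeg g q → l.length + 1 + q = k + 2 →
      cycSum (bracketList (TensorAlgebra.ι ℚ b) l) Q ∈ inclRange g k := by
  induction l using List.reverseRecOn with
  | nil =>
    intro q Q hQ hq
    obtain rfl : q = k + 1 := by simp at hq; omega
    simpa [bracketList, cycSum_ι] using ι_mul_mem_inclRange b hQ
  | append_singleton l c ih =>
    intro q Q hQ hq
    have hlen : l.length + 1 + (1 + q) = k + 2 := by simp at hq; omega
    have e : cycSum (bracketList (TensorAlgebra.ι ℚ b) (l ++ [c])) Q =
        cycSum (bracketList (TensorAlgebra.ι ℚ b) l)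
          (TensorAlgebra.ι ℚ c * Q - Q * TensorAlgebra.ι ℚ c) +
        TensorAlgebra.ι ℚ c * (Q * bracketList (TensorAlgebra.ι ℚ b) l -
          bracketList (TensorAlgebra.ι ℚ b) l * Q) := by
      rw [bracketList_append_singleton, cycSum_sub, cycSum_mul, cycSum_mul, cycSum_ι, cycSum_ι,
        map_sub, mul_sub]
      abel
    rw [e]
    refine Submodule.add_mem _ (ih (1 + q) _ (bracket_mem_lieDeg (ι_mem_lieDeg c) hQ) hlen)
      (ι_mul_mem_inclRange c ?_)
    have := bracket_mem_lieDeg hQ (bracketList_mem_lieDeg b l)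
    rwa [show q + (l.length + 1) = k + 1 by omega] at this

/-- The cyclic symmetrization of `X ⊗ [⋯[b, b_1], …, b_m]` lies in `𝔥_{g,1}(k)`. -/
theorem act_zeta_mem {k : ℕ} (X b : H g) (l : List (H g)) (hl : l.length = k)
    (v : ⨂[ℚ]^(k + 2) (H g))
    (hv : toTensorAlgebra v = TensorAlgebra.ι ℚ X * bracketList (TensorAlgebra.ι ℚ b) l) :
    act v (zeta (k + 2)) ∈ 𝔥 g k := by
  refine mem_of_rotate_eq ?_ (rotate_act_zeta v)
  have h : toTensorAlgebra (act v (zeta (k + 2))) ∈ inclRange g k := by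
    rw [toTensorAlgebra_act_zeta, hv, cycSum_mul, cycSum_ι, mul_one, one_mul]
    refine Submodule.add_mem _ (ι_mul_mem_inclRange X ?_)
      (cycSum_bracketList_mem b l 1 _ (ι_mem_lieDeg X) (by omega))
    simpa [hl] using bracketList_mem_lieDeg b l
  obtain ⟨w, hw, hwv⟩ := h
  rwa [← toTensorAlgebra_injective hwv]

end LeftNormed

/-! ## The tensor of a list of vectors -/

section Tens

variable {g : ℕ}

/-- The tensor `l_0 ⊗ ⋯ ⊗ l_{n-1}` of the entries of a list of `n` vectors. -/
def tens (n : ℕ) (l : List (H g)) : ⨂[ℚ]^n (H g) :=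
  PiTensorProduct.tprod ℚ fun i : Fin n => l.getD i 0

theorem tens_ofFn {n : ℕ} (a : Fin n → H g) : tens n (List.ofFn a) = PiTensorProduct.tprod ℚ a := by
  simp [tens]

theorem place_tens {n : ℕ} (τ : Equiv.Perm (Fin n)) (l : List (H g)) :
    place g n τ (tens n l) = tens n (List.ofFn fun i => l.getD (τ i) 0) := by
  rw [tens, place_tprod, tens_ofFn]

theorem toTensorAlgebra_tens {n : ℕ} (l : List (H g)) (hl : l.length = n) :
    toTensorAlgebra (tens n l) = (l.map (TensorAlgebra.ι ℚ)).prod := by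
  subst hl
  rw [tens, toTensorAlgebra_tprod_eq_prod]
  congr 1
  refine List.ext_getElem (by simp) fun i h₁ h₂ => ?_
  simp only [List.length_map] at h₂
  simp

end Tens

/-! ## The element `θ` as a left-normed bracketing -/

section Theta

variable {g : ℕ}

/-- Move the entry in place `m + 2` of a list to place `1`. -/
def moveToFront {α : Type*} (m : ℕ) (l : List α) : List α :=
  l.take 1 ++ ((l.drop (m + 2)).take 1 ++ ((l.drop 1).take (m + 1) ++ l.drop (m + 3)))

theorem exists_list_ten {α : Type*} (l : List α) (hl : l.length = 10) :
    ∃ x₀ x₁ x₂ x₃ x₄ x₅ x₆ x₇ x₈ x₉, l = [x₀, x₁, x₂, x₃, x₄, x₅, x₆, x₇, x₈, x₉] := by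
  match l, hl with
  | [x₀, x₁, x₂, x₃, x₄, x₅, x₆, x₇, x₈, x₉], _ => exact ⟨_, _, _, _, _, _, _, _, _, _, rfl⟩

theorem place_sProd_tens {m : ℕ} (hm : m < 8) (l : List (H g)) (hl : l.length = 10) :
    place g 10 (sProd (m + 1)) (tens 10 l) = tens 10 (moveToFront m l) := by
  obtain ⟨x₀, x₁, x₂, x₃, x₄, x₅, x₆, x₇, x₈, x₉, rfl⟩ := exists_list_ten l hl
  rw [place_tens]
  congr 1
  interval_cases m <;> rfl

theorem length_moveToFront {α : Type*} {m : ℕ} (hm : m < 8) (l : List α) (hl : l.length = 10) :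
    (moveToFront m l).length = 10 := by
  simp [moveToFront, hl]
  omega

theorem bracketList_sub (P P' : TA g) (l : List (H g)) :
    bracketList (P - P') l = bracketList P l - bracketList P' l := by
  induction l generalizing P P' with
  | nil => rfl
  | cons c l ih =>
    simp only [bracketList, List.foldl_cons] at *
    rw [← ih]
    congr 1
    simp only [sub_mul, mul_sub]
    abel

/-- The product of the last `d` factors of `θ`. -/
def thetaTail (d : ℕ) : MonoidAlgebra ℚ (Equiv.Perm (Fin 10)) :=
  (((List.range 8).drop (8 - d)).map fun m =>
    1 - MonoidAlgebra.of ℚ (Equiv.Perm (Fin 10)) (sProd (m + 1))).prod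

theorem thetaTail_succ {d : ℕ} (hd : d < 8) : thetaTail (d + 1) =
    (1 - MonoidAlgebra.of ℚ (Equiv.Perm (Fin 10)) (sProd (7 - d + 1))) * thetaTail d := by
  have h : (List.range 8).drop (8 - (d + 1)) = (7 - d) :: (List.range 8).drop (8 - d) := by
    interval_cases d <;> rfl
  rw [thetaTail, thetaTail, h, List.map_cons, List.prod_cons]

/-- The last d factors of θ bracket the last d letters onto the product P of the letters before
them. The factor in front of them subtracts the word with the letter c after P moved before P, so it
turns P c into P c - c P. -/
theorem toTensorAlgebra_act_thetaTail {d : ℕ} (hd : d ≤ 8) : ∀ (X : H g) (l : List (H g)),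
    l.length = 9 → toTensorAlgebra (act (tens 10 (X :: l)) (thetaTail d)) =
      TensorAlgebra.ι ℚ X *
        bracketList ((l.take (9 - d)).map (TensorAlgebra.ι ℚ)).prod (l.drop (9 - d)) := by
  induction d with
  | zero =>
    intro X l hl
    have h : thetaTail 0 = 1 := rfl
    rw [h, act_one, toTensorAlgebra_tens _ (by simp [hl]), ← hl]
    simp [bracketList]
  | succ d ih =>
    intro X l hl
    have hd' : d < 8 := by omega
    have hm : moveToFront (7 - d) (X :: l) =
        X :: ((l.drop (8 - d)).take 1 ++ (l.take (8 - d) ++ l.drop (9 - d))) := by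
      simp only [moveToFront, List.take_succ_cons, List.take_zero, List.drop_succ_cons,
        List.drop_zero, List.singleton_append]
      rw [show 7 - d + 1 = 8 - d by omega, show 7 - d + 2 = 9 - d by omega]
    have hsub : act (tens 10 (X :: l)) (thetaTail (d + 1)) =
        act (tens 10 (X :: l)) (thetaTail d) -
          act (tens 10 (moveToFront (7 - d) (X :: l))) (thetaTail d) := by
      rw [thetaTail_succ hd', act_mul, act_sub, act_one, act_of,
        place_sProd_tens (by omega) _ (by simp [hl]), act_eq, map_sub, ← act_eq, ← act_eq]
    have hlen : 8 - d < l.length := by omega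
    rw [hsub, map_sub, hm, ih (by omega) X l hl, ih (by omega) X _ (by simp; omega), ← mul_sub,
      show 9 - (d + 1) = 8 - d by omega, show 9 - d = 8 - d + 1 by omega,
      List.drop_eq_getElem_cons hlen, List.take_succ_eq_append_getElem hlen]
    congr 1
    -- Here c is the next letter to be bracketed: the unmoved word begins with P c, the moved one
    -- with c P.
    generalize hc : l[8 - d] = c
    have h1 : ((c :: l.drop (8 - d + 1)).take 1 ++ (l.take (8 - d) ++ l.drop (8 - d + 1))) =
        (c :: l.take (8 - d)) ++ l.drop (8 - d + 1) := by simp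
    have h2 : (c :: l.take (8 - d)).length = 8 - d + 1 := by simp; omega
    rw [h1, List.take_left' h2, List.drop_left' h2, ← bracketList_sub]
    simp [bracketList]

theorem toTensorAlgebra_act_theta (X b : H g) (l : List (H g)) (hl : l.length = 8) :
    toTensorAlgebra (act (tens 10 (X :: b :: l)) theta) =
      TensorAlgebra.ι ℚ X * bracketList (TensorAlgebra.ι ℚ b) l := by
  have h := toTensorAlgebra_act_thetaTail le_rfl X (b :: l) (by simp [hl])
  have h8 : thetaTail 8 = theta := rfl
  simpa [h8] using h

theorem act_theta_zeta_mem (v : ⨂[ℚ]^10 (H g)) : act (act v theta) (zeta 10) ∈ 𝔥 g 8 := by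
  have h : ∀ a : Fin 10 → H g,
      act (act (PiTensorProduct.tprod ℚ a) theta) (zeta 10) ∈ 𝔥 g 8 := fun a => by
    rw [← tens_ofFn]
    refine act_zeta_mem (k := 8) (a 0) (a 1) (List.ofFn fun i : Fin 8 => a i.succ.succ) (by simp)
      _ ?_
    rw [← toTensorAlgebra_act_theta _ _ _ (by simp), List.ofFn_succ, List.ofFn_succ]
    rfl
  induction v using PiTensorProduct.induction_on with
  | smul_tprod r a =>
    rw [act_eq, act_eq, map_smul, map_smul]
    exact Submodule.smul_mem _ r (h a)
  | add x y hx hy =>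
    rw [act_eq, act_eq, map_add, map_add]
    exact Submodule.add_mem _ hx hy

theorem vThetaZeta_mem (g : ℕ) : vThetaZeta g ∈ 𝔥 g 8 := act_theta_zeta_mem _

end Theta

end FreeLie

/-! ## The symplectic form -/

section Form

variable {g : ℕ}

theorem J_transpose (g : ℕ) : (J g).transpose = -J g := by
  ext i j
  simp only [Matrix.transpose_apply, Matrix.neg_apply, J, Fin.ext_iff, Fin.val_rev]
  have := i.isLt
  have := j.isLt
  split_ifs <;> first | omega | norm_num

theorem form_swap (x y : H g) : form g x y = -form g y x := by
  have h : (J g).transpose.mulVec x = -(J g).mulVec x := by rw [J_transpose, Matrix.neg_mulVec]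
  simp only [form, Matrix.toBilin'_apply']
  rw [Matrix.dotProduct_mulVec, ← Matrix.mulVec_transpose, h, neg_dotProduct, dotProduct_comm]

end Form

/-! ## The map `δ_k^alg` on cyclically invariant tensors -/

section Delta

variable {g : ℕ}

theorem varpi_tprod {k p q : ℕ} (h : p + q = k) (a : Fin k → H g) :
    varpi g h (PiTensorProduct.tprod ℚ a) =
      proj g p (PiTensorProduct.tprod ℚ fun t => a (Fin.cast h (Fin.castAdd q t))) ⊗ₜ[ℚ]
        proj g q (PiTensorProduct.tprod ℚ fun t => a (Fin.cast h (Fin.natAdd p t))) := by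
  subst h
  have e : PiTensorProduct.tprod ℚ a = TensorPower.mulEquiv (R := ℚ) (M := H g) (n := p) (m := q)
      (PiTensorProduct.tprod ℚ (fun t => a (Fin.castAdd q t)) ⊗ₜ
        PiTensorProduct.tprod ℚ (fun t => a (Fin.natAdd p t))) := by
    have := TensorPower.tprod_mul_tprod (R := ℚ) (fun t : Fin p => a (Fin.castAdd q t))
      (fun t : Fin q => a (Fin.natAdd p t))
    rw [TensorPower.gMul_def] at this
    rw [this]
    congr 1
    exact (Fin.append_castAdd_natAdd).symm
  simp only [varpi, LinearMap.comp_apply, LinearEquiv.coe_coe, TensorPower.cast_refl,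
    LinearEquiv.refl_apply, Fin.cast_refl, id]
  rw [e, LinearEquiv.symm_apply_apply, TensorProduct.map_tmul]

theorem contract_tprod {n m : ℕ} (i j : Fin n) (f : Fin m → Fin n) (h : Complementary i j f)
    (a : Fin n → H g) : contract g i j f h (PiTensorProduct.tprod ℚ a) =
      form g (a i) (a j) • PiTensorProduct.tprod ℚ (fun t => a (f t)) := by
  simp [contract, contractMulti]

theorem val_finRotate_pow_of_le {n m : ℕ} (hm : m ≤ n) (i : Fin n) :
    ((finRotate n ^ m) i).val = if i.val + m < n then i.val + m else i.val + m - n := by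
  rw [val_finRotate_pow]
  split_ifs with h
  · exact Nat.mod_eq_of_lt h
  · rw [Nat.mod_eq_sub_mod (by omega), Nat.mod_eq_of_lt (by omega)]

/-- Rotating by i brings place i to the front and place j to place j - i; the other places then
follow in the order of the two arcs. -/
theorem contract_arcs {k : ℕ} (i j : Fin (k + 2)) (hij : i < j) (w : ⨂[ℚ]^(k + 2) (H g)) :
    contract g i j (arcs i j hij) (complementary_arcs i j hij) w =
      Phi g k (j.val - i.val) (by have : i.val < j.val := hij; omega)
        (by have := j.isLt; have : i.val < j.val := hij; omega)
        (place g (k + 2) (finRotate (k + 2) ^ i.val) w) := by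
  have hij' : i.val < j.val := hij
  have hj := j.isLt
  suffices h : contract g i j (arcs i j hij) (complementary_arcs i j hij) =
      Phi g k (j.val - i.val) (by omega) (by omega) ∘ₗ
        place g (k + 2) (finRotate (k + 2) ^ i.val) from LinearMap.congr_fun h w
  refine PiTensorProduct.ext (MultilinearMap.ext fun a => ?_)
  simp only [LinearMap.compMultilinearMap_apply, LinearMap.comp_apply, place_tprod, Phi,
    contract_tprod]
  have h0 : (finRotate (k + 2) ^ i.val) 0 = i := by
    ext
    rw [val_finRotate_pow_of_le (by omega)]
    simp
  have h1 : ∀ h, (finRotate (k + 2) ^ i.val) (Fin.succ ⟨j.val - i.val - 1, h⟩) = j := fun h => by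
    ext
    rw [val_finRotate_pow_of_le (by omega)]
    simp only [Fin.val_succ]
    split_ifs <;> omega
  have h2 : ∀ h t, (finRotate (k + 2) ^ i.val)
      (Fin.succAbove ⟨j.val - i.val - 1, h⟩ t).succ = arcs i j hij t := fun h t => by
    ext
    rw [val_finRotate_pow_of_le (by omega)]
    simp only [Fin.succAbove, Fin.lt_def, arcs, Fin.val_castSucc, Fin.val_succ,
      apply_ite Fin.val, apply_dite Fin.val]
    split_ifs <;> omega
  rw [h0, h1]
  congr 2
  ext1 t
  rw [h2]

/-- Rotating by j instead brings place i to place k + 2 - (j - i) = q + 1 and lists the two arcs in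
the opposite order. The contracted vectors have changed roles, whence the sign. -/
theorem comm_varpi_contract_arcs {k : ℕ} (i j : Fin (k + 2)) (hij : i < j)
    {p q l : ℕ} (hp : p + 1 = j.val - i.val) (hpq : p + q = k) (hqp : q + p = k) (hl : l = q + 1)
    (w : ⨂[ℚ]^(k + 2) (H g)) :
    TensorProduct.comm ℚ (C g p) (C g q) (varpi g hpq
      (contract g i j (arcs i j hij) (complementary_arcs i j hij) w)) =
      -varpi g hqp (Phi g k l (by omega) (by omega)
        (place g (k + 2) (finRotate (k + 2) ^ j.val) w)) := by
  have hij' : i.val < j.val := hij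
  have hj := j.isLt
  suffices h : (TensorProduct.comm ℚ (C g p) (C g q)).toLinearMap ∘ₗ varpi g hpq ∘ₗ
      contract g i j (arcs i j hij) (complementary_arcs i j hij) =
      -(varpi g hqp ∘ₗ Phi g k l (by omega) (by omega) ∘ₗ
        place g (k + 2) (finRotate (k + 2) ^ j.val)) from LinearMap.congr_fun h w
  refine PiTensorProduct.ext (MultilinearMap.ext fun a => ?_)
  simp only [LinearMap.compMultilinearMap_apply, LinearMap.comp_apply, LinearMap.neg_apply,
    place_tprod, Phi, contract_tprod, map_smul, varpi_tprod, LinearEquiv.coe_coe,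
    TensorProduct.comm_tmul]
  have h0 : (finRotate (k + 2) ^ j.val) 0 = j := by
    ext
    rw [val_finRotate_pow_of_le (by omega)]
    simp
  have h1 : ∀ h, (finRotate (k + 2) ^ j.val) (Fin.succ ⟨l - 1, h⟩) = i := fun h => by
    ext
    rw [val_finRotate_pow_of_le (by omega)]
    simp only [Fin.val_succ]
    split_ifs <;> omega
  have h2 : ∀ h (t : Fin q), (finRotate (k + 2) ^ j.val)
      (Fin.succAbove ⟨l - 1, h⟩ (Fin.cast hqp (Fin.castAdd p t))).succ =
        arcs i j hij (Fin.cast hpq (Fin.natAdd p t)) := fun h t => by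
    ext
    rw [val_finRotate_pow_of_le (by omega)]
    simp only [Fin.succAbove, Fin.lt_def, arcs, Fin.val_castSucc, Fin.val_cast, Fin.val_castAdd,
      Fin.val_natAdd, Fin.val_succ, apply_ite Fin.val, apply_dite Fin.val]
    split_ifs <;> omega
  have h3 : ∀ h (t : Fin p), (finRotate (k + 2) ^ j.val)
      (Fin.succAbove ⟨l - 1, h⟩ (Fin.cast hqp (Fin.natAdd q t))).succ =
        arcs i j hij (Fin.cast hpq (Fin.castAdd q t)) := fun h t => by
    ext
    rw [val_finRotate_pow_of_le (by omega)]
    simp only [Fin.succAbove, Fin.lt_def, arcs, Fin.val_castSucc, Fin.val_cast, Fin.val_castAdd,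
      Fin.val_natAdd, Fin.val_succ, apply_ite Fin.val, apply_dite Fin.val]
    split_ifs <;> omega
  simp only [h0, h1, h2, h3]
  rw [form_swap, neg_smul]

theorem place_finRotate_pow_of_invariant {n : ℕ} {w : ⨂[ℚ]^n (H g)}
    (hw : place g n (finRotate n) w = w) (m : ℕ) : place g n (finRotate n ^ m) w = w := by
  induction m with
  | zero => rw [pow_zero, ← act_of, map_one, act_one]
  | succ m ih => rw [pow_succ, place_mul_apply, ih, hw]

/-- `Θ_ℓ` as a map to the direct sum, zero outside the range `2 ≤ ℓ ≤ k`. -/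
def thetaCC (g k l : ℕ) : ⨂[ℚ]^(k + 2) (H g) →ₗ[ℚ] CC g k :=
  if h : 2 ≤ l ∧ l ≤ k then
    inCC g (p := l - 1) (q := k + 1 - l) (by omega) ∘ₗ Theta g k l (by omega) (by omega) else 0

theorem thetaCC_apply {k l p q : ℕ} (h : 1 ≤ p ∧ 1 ≤ q ∧ p + q = k) (hl : l = p + 1)
    (w : ⨂[ℚ]^(k + 2) (H g)) : thetaCC g k l w =
      inCC g h (varpi g h.2.2 (Phi g k l (by omega) (by omega) w)) := by
  obtain rfl : p = l - 1 := by omega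
  obtain rfl : q = k + 1 - l := by omega
  rw [thetaCC, dif_pos (by omega)]
  rfl

theorem deltaAlg_eq_sum {k : ℕ} {w : ⨂[ℚ]^(k + 2) (H g)}
    (hw : place g (k + 2) (finRotate (k + 2)) w = w) :
    deltaAlg g k w = ∑ i : Fin (k + 2), ∑ j : Fin (k + 2),
      if i < j ∧ 1 < j.val - i.val ∧ j.val - i.val < k + 1 then
        thetaCC g k (j.val - i.val) w + thetaCC g k (k + 2 - (j.val - i.val)) w else 0 := by
  simp only [deltaAlg, LinearMap.sum_apply]
  refine Finset.sum_congr rfl fun i _ => Finset.sum_congr rfl fun j _ => ?_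
  split_ifs with h
  · have hij : i.val < j.val := h.1
    simp only [LinearMap.comp_apply, LinearMap.sub_apply, LinearEquiv.coe_coe]
    rw [comm_varpi_contract_arcs i j h.1 (by omega) (by omega) (by omega) rfl, contract_arcs,
      place_finRotate_pow_of_invariant hw, place_finRotate_pow_of_invariant hw, map_neg,
      sub_neg_eq_add]
    congr 1
    · rw [thetaCC_apply (p := j.val - i.val - 1) (q := k + 1 - (j.val - i.val)) (by omega)
        (by omega)]
    · obtain ⟨l, hl⟩ : ∃ l, l = k + 2 - (j.val - i.val) := ⟨_, rfl⟩
      obtain ⟨l', hl'⟩ : ∃ l', l' = k + 1 - (j.val - i.val) + 1 := ⟨_, rfl⟩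
      obtain rfl : l = l' := by omega
      rw [← hl, thetaCC_apply (p := k + 1 - (j.val - i.val)) (q := j.val - i.val - 1) (by omega)
        hl']
      subst hl'
      rfl
  · rfl

theorem deltaAlg_eq_of_invariant {w : ⨂[ℚ]^(8 + 2) (H g)}
    (hw : place g (8 + 2) (finRotate (8 + 2)) w = w) :
    deltaAlg g 8 w = (10 : ℚ) • ThetaSum g 8 w := by
  have hS : ThetaSum g 8 w = ∑ l ∈ Finset.range 9, thetaCC g 8 l w := by
    simp only [ThetaSum, LinearMap.sum_apply]
    rfl
  -- Only ℓ = 2, …, 8 contribute; the terms at 0 and 1 are zero by convention.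
  have h0 : thetaCC g 8 0 w = 0 := rfl
  have h1 : thetaCC g 8 1 w = 0 := rfl
  rw [deltaAlg_eq_sum hw, hS]
  generalize hf : (fun l => thetaCC g 8 l w) = f
  have hf' : ∀ l, thetaCC g 8 l w = f l := fun l => congrFun hf l
  simp only [hf'] at h0 h1 ⊢
  simp only [Finset.sum_range_succ, Finset.sum_range_zero, h0, h1]
  have hr : ∀ F : ℕ → ℕ → CC g 8, ∑ i : Fin (8 + 2), ∑ j : Fin (8 + 2), F i j =
      ∑ i ∈ Finset.range 10, ∑ j ∈ Finset.range 10, F i j := fun F => by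
    rw [← Fin.sum_univ_eq_sum_range (fun i => ∑ j ∈ Finset.range 10, F i j) 10]
    exact Finset.sum_congr rfl fun i _ => Fin.sum_univ_eq_sum_range _ 10
  simp only [Fin.lt_def]
  rw [hr fun i j =>
    if i < j ∧ 1 < j - i ∧ j - i < 8 + 1 then f (j - i) + f (8 + 2 - (j - i)) else 0]
  -- Once the double sum is written out, f d has coefficient 10 - d from the pairs at difference d
  -- and d from those at difference 10 - d.
  simp [Finset.sum_range_succ]
  module

end Delta

/-! ## The action of triangular symplectic matrices -/

section Maximal

variable {g : ℕ}

theorem e_succ_eq_single (r : Fin (2 * g)) : e g (r.val + 1) = Pi.single r 1 := by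
  ext j
  simp [e, Pi.single_apply, Fin.ext_iff]

theorem eStar_succ (r : Fin (2 * g)) : eStar g (r.val + 1) = J g r := by
  have := r.isLt
  ext j
  have := j.isLt
  simp only [eStar, J, Fin.ext_iff, Fin.val_rev]
  split_ifs <;> simp [e] <;> omega

theorem sum_Icc_eq_sum_fin {N : Type*} [AddCommMonoid N] (n : ℕ) (F : ℕ → N) :
    ∑ r ∈ Finset.Icc 1 n, F r = ∑ r : Fin n, F (r.val + 1) := by
  rw [Fin.sum_univ_eq_sum_range (fun r => F (r + 1)) n, Finset.range_eq_Ico,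
    Finset.sum_Ico_add' F 0 n 1]
  rfl

/-- The element `ω = ∑ e_r ⊗ e_r^*` of the tensor algebra. -/
def omegaTA (g : ℕ) : TA g :=
  ∑ r ∈ Finset.Icc 1 (2 * g), TensorAlgebra.ι ℚ (e g r) * TensorAlgebra.ι ℚ (eStar g r)

/-- The element `e_1 ∧ ⋯ ∧ e_6` of the tensor algebra. -/
def wedgeTA (g : ℕ) : TA g :=
  MultilinearMap.alternatization (TensorAlgebra.tprod ℚ (H g) 6) fun c => e g (c.val + 1)

theorem toTensorAlgebra_vHook (g : ℕ) : toTensorAlgebra (vHook g) =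
    omegaTA g * wedgeTA g * (TensorAlgebra.ι ℚ (e g 1) * TensorAlgebra.ι ℚ (e g 1)) := by
  simp only [vHook, omegaTA, wedgeTA, map_sum, map_smul, Finset.sum_mul,
    MultilinearMap.alternatization_apply, Finset.mul_sum, toTensorAlgebra_tprod_eq_prod]
  rw [Finset.sum_comm]
  refine Finset.sum_congr rfl fun σ _ => Finset.sum_congr rfl fun r _ => ?_
  rw [Units.smul_def, ← Int.cast_smul_eq_zsmul ℚ]
  simp [List.ofFn_succ, mul_assoc, TensorAlgebra.tprod_apply]

/-- A tensor of degree two is encoded by its coefficient matrix. For ω this matrix is J, so a matrix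
B replaces it by B J ᵗB. -/
theorem sum_ι_mul_ι (B D : Matrix (Fin (2 * g)) (Fin (2 * g)) ℚ) :
    ∑ r, TensorAlgebra.ι ℚ (fun j => B j r) * TensorAlgebra.ι ℚ (fun j => D j r) =
      ∑ s, ∑ t, (B * D.transpose) s t •
        (TensorAlgebra.ι ℚ (Pi.single s 1 : H g) * TensorAlgebra.ι ℚ (Pi.single t 1 : H g)) := by
  have h : ∀ v : H g, TensorAlgebra.ι ℚ v =
      ∑ s, v s • TensorAlgebra.ι ℚ (Pi.single s 1 : H g) := fun v => by
    conv_lhs => rw [pi_eq_sum_univ' v]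
    simp [map_sum]
  simp_rw [h (fun j => B j _), h (fun j => D j _), Finset.sum_mul_sum, smul_mul_smul_comm,
    Matrix.mul_apply, Matrix.transpose_apply, Finset.sum_smul]
  rw [Finset.sum_comm]
  refine Finset.sum_congr rfl fun s _ => ?_
  rw [Finset.sum_comm]

theorem J_mul_J (g : ℕ) : J g * J g = -1 := by
  ext i j
  simp only [Matrix.mul_apply, J, Matrix.neg_apply, Matrix.one_apply]
  rw [Finset.sum_eq_single i.rev (fun k _ hk => by simp [hk]) (by simp)]
  have := i.isLt
  simp only [Fin.ext_iff, Fin.val_rev]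
  split_ifs <;> first | omega | norm_num

/-- Since J² = -1, the hypothesis makes -J ᵗA J a left inverse of A, hence a right inverse. -/
theorem symplectic_transpose {A : Matrix (Fin (2 * g)) (Fin (2 * g)) ℚ}
    (hA : A.transpose * J g * A = J g) : A * J g * A.transpose = J g := by
  have h1 : -(J g * A.transpose * J g) * A = 1 := by
    rw [neg_mul, mul_assoc, mul_assoc, ← mul_assoc A.transpose, hA, J_mul_J, neg_neg]
  have h2 := mul_eq_one_comm.1 h1
  have h3 : A * J g * A.transpose * J g * J g = -J g := by
    rw [mul_neg] at h2
    rw [show A * J g * A.transpose * J g = A * (J g * A.transpose * J g) by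
      simp only [mul_assoc], neg_eq_iff_eq_neg.1 h2, neg_one_mul]
  rw [mul_assoc, J_mul_J, mul_neg, mul_one] at h3
  exact neg_injective h3

/-- The endomorphism of the tensor algebra induced by a matrix. -/
def mapTA (A : Matrix (Fin (2 * g)) (Fin (2 * g)) ℚ) : TA g →ₐ[ℚ] TA g :=
  TensorAlgebra.lift ℚ (TensorAlgebra.ι ℚ ∘ₗ Matrix.toLin' A)

theorem mapTA_ι (A : Matrix (Fin (2 * g)) (Fin (2 * g)) ℚ) (v : H g) :
    mapTA A (TensorAlgebra.ι ℚ v) = TensorAlgebra.ι ℚ (A.mulVec v) := by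
  simp [mapTA]

theorem mapTA_omegaTA {A : Matrix (Fin (2 * g)) (Fin (2 * g)) ℚ}
    (hA : A.transpose * J g * A = J g) : mapTA A (omegaTA g) = omegaTA g := by
  have h : ∀ B : Matrix (Fin (2 * g)) (Fin (2 * g)) ℚ, mapTA B (omegaTA g) =
      ∑ s, ∑ t, (B * J g * B.transpose) s t •
        (TensorAlgebra.ι ℚ (Pi.single s 1 : H g) * TensorAlgebra.ι ℚ (Pi.single t 1 : H g)) := by
    intro B
    simp only [omegaTA, map_sum, map_mul, mapTA_ι]
    rw [sum_Icc_eq_sum_fin]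
    simp_rw [e_succ_eq_single, eStar_succ]
    have h1 : ∀ r, B.mulVec (Pi.single r 1) = fun j => B j r := fun r => by
      rw [Matrix.mulVec_single_one]; rfl
    have h2 : ∀ r, B.mulVec (J g r) = fun j => (B * (J g).transpose) j r := fun r => rfl
    simp_rw [h1, h2]
    rw [sum_ι_mul_ι, Matrix.transpose_mul, Matrix.transpose_transpose, ← mul_assoc]
  have h1 := h 1
  rw [h A, symplectic_transpose hA]
  simp only [one_mul, Matrix.transpose_one, mul_one] at h1
  rw [← h1]
  have : mapTA (1 : Matrix (Fin (2 * g)) (Fin (2 * g)) ℚ) = AlgHom.id ℚ _ := by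
    refine TensorAlgebra.hom_ext (LinearMap.ext fun v => ?_)
    simp [mapTA_ι]
  rw [this]
  rfl

/-- Both sides are alternating in the columns of M, so it is enough to compare them on the standard
basis up to permutation. -/
theorem alternatingMap_apply_matrix {V N : Type*} [AddCommGroup V] [Module ℚ V] [AddCommGroup N]
    [Module ℚ N] {n : ℕ} (f : V [⋀^Fin n]→ₗ[ℚ] N) (b : Fin n → V)
    (M : Matrix (Fin n) (Fin n) ℚ) :
    f (fun c => ∑ c', M c' c • b c') = M.det • f b := by
  let L : (Fin n → ℚ) →ₗ[ℚ] V := Fintype.linearCombination ℚ b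
  let F := f.compLinearMap L
  let G : (Fin n → ℚ) [⋀^Fin n]→ₗ[ℚ] N :=
    (LinearMap.toSpanSingleton ℚ N (f b)).compAlternatingMap (Pi.basisFun ℚ (Fin n)).det
  have hL : ∀ c, L (Pi.single c 1) = b c := fun c => by
    simp [L, Fintype.linearCombination_apply_single]
  have hFG : F = G := by
    refine Module.Basis.ext_alternating (Pi.basisFun ℚ (Fin n)) fun v hv => ?_
    let σ : Equiv.Perm (Fin n) := Equiv.ofBijective v (Finite.injective_iff_bijective.1 hv)
    have hF : F (fun i => Pi.basisFun ℚ (Fin n) i) = f b := by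
      simp [F, hL]
    have hG : G (fun i => Pi.basisFun ℚ (Fin n) i) = f b := by
      have : (Pi.basisFun ℚ (Fin n)).det (Pi.basisFun ℚ (Fin n)) = 1 := Module.Basis.det_self _
      simp only [G, LinearMap.compAlternatingMap_apply]
      erw [this]
      simp
    have h1 := F.map_perm (fun i => Pi.basisFun ℚ (Fin n) i) σ
    have h2 := G.map_perm (fun i => Pi.basisFun ℚ (Fin n) i) σ
    rw [hF, ← hG, ← h2] at h1
    exact h1
  have hM : (fun c => ∑ c', M c' c • b c') = fun c => L (fun c' => M c' c) := by
    ext1 c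
    simp [L, Fintype.linearCombination_apply]
  rw [hM]
  change F (fun c c' => M c' c) = _
  rw [hFG]
  have hdet : (Pi.basisFun ℚ (Fin n)).det (fun c c' => M c' c) = M.det := by
    rw [Pi.basisFun_det_apply]
    exact Matrix.det_transpose M
  simp only [G, LinearMap.compAlternatingMap_apply, hdet, LinearMap.toSpanSingleton_apply]

/-- An upper triangular matrix preserves the span of e_1, …, e_6 and acts there by its leading 6 × 6
block, whose determinant is the product of its diagonal entries. -/
theorem mapTA_wedgeTA (hg : 6 ≤ g) {A : Matrix (Fin (2 * g)) (Fin (2 * g)) ℚ}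
    (hA : A.BlockTriangular id) : mapTA A (wedgeTA g) =
      (∏ c : Fin 6, A ⟨c, by omega⟩ ⟨c, by omega⟩) • wedgeTA g := by
  let M : Matrix (Fin 6) (Fin 6) ℚ := fun c' c => A ⟨c', by omega⟩ ⟨c, by omega⟩
  have hM : M.BlockTriangular id := fun i j hij => hA hij
  have h1 : mapTA A (wedgeTA g) = MultilinearMap.alternatization (TensorAlgebra.tprod ℚ (H g) 6)
      fun c => A.mulVec (e g (c.val + 1)) := by
    simp only [wedgeTA, MultilinearMap.alternatization_apply, map_sum, Units.smul_def, map_zsmul,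
      MultilinearMap.domDomCongr_apply, TensorAlgebra.tprod_apply, map_list_prod, List.map_ofFn,
      Function.comp_def, mapTA_ι]
  have h2 : (fun c : Fin 6 => A.mulVec (e g (c.val + 1))) =
      fun c => ∑ c' : Fin 6, M c' c • e g (c'.val + 1) := by
    ext c j
    have hc : A.mulVec (e g (c.val + 1)) j = A j ⟨c, by omega⟩ := by
      have := e_succ_eq_single (g := g) ⟨c, by omega⟩
      simp only at this
      rw [this, Matrix.mulVec_single_one]
      rfl
    rw [hc, Finset.sum_apply]
    by_cases hj : j.val < 6
    · rw [Finset.sum_eq_single ⟨j.val, hj⟩]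
      · simp [e, M]
      · intro c' _ hc'
        have : j.val ≠ c'.val := fun h => hc' (Fin.ext h.symm)
        simp [e, this]
      · simp
    · rw [Finset.sum_eq_zero, hA]
      · simp only [id, Fin.lt_def]; omega
      · intro c' _
        have : j.val ≠ c'.val := by omega
        simp [e, this]
  rw [h1, h2, alternatingMap_apply_matrix, Matrix.det_of_isUpperTriangular hM]
  simp only [M, wedgeTA]

theorem matAct_vHook (hg : 6 ≤ g) {A : Matrix (Fin (2 * g)) (Fin (2 * g)) ℚ}
    (hJ : A.transpose * J g * A = J g) (hA : A.BlockTriangular id) :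
    matAct g 10 A (vHook g) = ((∏ c : Fin 6, A ⟨c, by omega⟩ ⟨c, by omega⟩) *
      A ⟨0, by omega⟩ ⟨0, by omega⟩ ^ 2) • vHook g := by
  apply toTensorAlgebra_injective
  have h1 : A.mulVec (e g 1) = A ⟨0, by omega⟩ ⟨0, by omega⟩ • e g 1 := by
    have h := e_succ_eq_single (g := g) ⟨0, by omega⟩
    simp only [zero_add] at h
    ext j
    rw [h, Matrix.mulVec_single_one]
    by_cases hj : j = ⟨0, by omega⟩
    · subst hj; simp
    · have : (⟨0, by omega⟩ : Fin (2 * g)) < j := by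
        rw [Fin.lt_def]
        simp only [Fin.ext_iff] at hj
        simp only
        omega
      simp [hj, hA this]
  rw [toTensorAlgebra_matAct, map_smul, toTensorAlgebra_vHook]
  change mapTA A _ = _
  rw [map_mul, map_mul, map_mul, mapTA_omegaTA hJ, mapTA_wedgeTA hg hA, mapTA_ι, h1, map_smul]
  simp only [mul_smul_comm, smul_mul_assoc, smul_smul]
  congr 1
  ring

theorem diagonal_symplectic {d : Fin (2 * g) → ℚ} (hd : ∀ i, d i * d i.rev = 1) :
    (Matrix.diagonal d).transpose * J g * Matrix.diagonal d = J g := by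
  ext i j
  rw [Matrix.diagonal_transpose, Matrix.mul_diagonal, Matrix.diagonal_mul]
  simp only [J]
  split_ifs with h
  · subst h; linear_combination hd i
  · subst h; linear_combination -hd i
  · simp

theorem prod_weight (hg : 6 ≤ g) (d : Fin (2 * g) → ℚ) :
    (∏ i : Fin (2 * g), if i.val < g then d i ^ [3, 1, 1, 1, 1, 1].getD i.val 0 else 1) =
      (∏ c : Fin 6, d ⟨c, by omega⟩) * d ⟨0, by omega⟩ ^ 2 := by
  let F : ℕ → ℚ := fun i => if h : i < g then d ⟨i, by omega⟩ ^ [3, 1, 1, 1, 1, 1].getD i 0 else 1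
  have h1 : (∏ i : Fin (2 * g), if i.val < g then d i ^ [3, 1, 1, 1, 1, 1].getD i.val 0 else 1) =
      ∏ i ∈ Finset.range (2 * g), F i := by
    rw [← Fin.prod_univ_eq_prod_range]
    refine Finset.prod_congr rfl fun i _ => ?_
    simp only [F]
    split_ifs <;> rfl
  have h2 : ∏ i ∈ Finset.range (2 * g), F i = ∏ i ∈ Finset.range 6, F i := by
    refine (Finset.prod_subset (Finset.range_subset_range.2 (by omega)) fun i _ hi => ?_).symm
    have hi' : 6 ≤ i := by simpa using hi
    have : [3, 1, 1, 1, 1, 1].getD i 0 = 0 := by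
      rw [List.getD_eq_default]
      simpa using hi'
    simp only [F, this, pow_zero]
    split_ifs <;> rfl
  have hF : ∀ i, (h : i < g) → F i = d ⟨i, by omega⟩ ^ [3, 1, 1, 1, 1, 1].getD i 0 := fun i h =>
    dif_pos h
  rw [h1, h2]
  simp only [Finset.prod_range_succ, Finset.prod_range_zero, Fin.prod_univ_succ]
  rw [hF 0 (by omega), hF 1 (by omega), hF 2 (by omega), hF 3 (by omega), hF 4 (by omega),
    hF 5 (by omega)]
  simp
  ring

theorem isSpMaximal_vThetaZeta (hg : 6 ≤ g) (h0 : vThetaZeta g ≠ 0) :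
    IsSpMaximal g [3, 1, 1, 1, 1, 1] (vThetaZeta g) where
  ne_zero := h0
  unipotent A hJ hA h1 := by
    rw [vThetaZeta, matAct_act, matAct_act, matAct_vHook hg hJ hA]
    simp [h1]
  torus d hd := by
    rw [vThetaZeta, matAct_act, matAct_act,
      matAct_vHook hg (diagonal_symplectic hd) (Matrix.blockTriangular_diagonal d), prod_weight hg]
    simp [act_eq]

end Maximal

/-! ## Formal linear combinations of words -/

section Comb

variable {N N' : Type*} [AddCommGroup N] [AddCommGroup N']

/-- A formal integral linear combination of words in the alphabet `ℕ`. -/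
abbrev Comb : Type := List (ℤ × List ℕ)

/-- The value of a formal linear combination under a map defined on words. -/
def evalComb (f : List ℕ → N) (L : Comb) : N := (L.map fun p => p.1 • f p.2).sum

theorem evalComb_nil (f : List ℕ → N) : evalComb f [] = 0 := rfl

theorem evalComb_cons (f : List ℕ → N) (p : ℤ × List ℕ) (L : Comb) :
    evalComb f (p :: L) = p.1 • f p.2 + evalComb f L := by
  simp [evalComb]

theorem evalComb_append (f : List ℕ → N) (L L' : Comb) :
    evalComb f (L ++ L') = evalComb f L + evalComb f L' := by
  simp [evalComb]

theorem evalComb_map_congr {f : List ℕ → N} {f' : List ℕ → N} {F : ℤ × List ℕ → ℤ × List ℕ}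
    {L : Comb} (h : ∀ p ∈ L, (F p).1 • f (F p).2 = p.1 • f' p.2) :
    evalComb f (L.map F) = evalComb f' L := by
  rw [evalComb, evalComb, List.map_map]
  exact congrArg List.sum (List.map_congr_left h)

theorem map_evalComb (φ : N →+ N') (f : List ℕ → N) (L : Comb) :
    φ (evalComb f L) = evalComb (fun w => φ (f w)) L := by
  simp [evalComb, map_list_sum, Function.comp_def]

/-- The combination `c · L`. -/
def smulComb (c : ℤ) (L : Comb) : Comb := L.map fun p => (c * p.1, p.2)

theorem evalComb_smulComb (f : List ℕ → N) (c : ℤ) (L : Comb) :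
    evalComb f (smulComb c L) = c • evalComb f L := by
  induction L with
  | nil => simp [smulComb, evalComb]
  | cons p L ih =>
    simp only [smulComb, List.map_cons, evalComb_cons] at *
    rw [ih, smul_add, mul_smul]

/-- Replace every word of a combination by a combination. -/
def bindComb (L : Comb) (F : List ℕ → Comb) : Comb := L.flatMap fun p => smulComb p.1 (F p.2)

theorem evalComb_bindComb (f : List ℕ → N) (L : Comb) (F : List ℕ → Comb) :
    evalComb f (bindComb L F) = evalComb (fun w => evalComb f (F w)) L := by
  induction L with
  | nil => rfl
  | cons p L ih =>
    rw [evalComb_cons, ← ih, bindComb, List.flatMap_cons, evalComb_append, evalComb_smulComb]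
    rfl

theorem evalComb_congr {f f' : List ℕ → N} {L : Comb} (h : ∀ p ∈ L, f p.2 = f' p.2) :
    evalComb f L = evalComb f' L := by
  have := evalComb_map_congr (f := f) (f' := f') (F := id) (L := L) fun p hp => by simp [h p hp]
  simpa using this

theorem evalComb_finset_sum {ι : Type*} (s : Finset ι) (f : ι → List ℕ → N) (L : Comb) :
    evalComb (fun w => ∑ r ∈ s, f r w) L = ∑ r ∈ s, evalComb (f r) L := by
  induction L with
  | nil => simp [evalComb_nil]
  | cons p L ih => simp only [evalComb_cons, ih, Finset.smul_sum, Finset.sum_add_distrib]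

/-- Boolean equality of words. -/
def eqWord : List ℕ → List ℕ → Bool
  | [], [] => true
  | a :: w, b :: w' => bif Nat.beq a b then eqWord w w' else false
  | _, _ => false

theorem eq_of_eqWord : ∀ {w w' : List ℕ}, eqWord w w' = true → w = w'
  | [], [], _ => rfl
  | a :: w, b :: w', h => by
    rw [eqWord, Bool.cond_eq_ite] at h
    split_ifs at h with hab
    rw [Nat.eq_of_beq_eq_true hab, eq_of_eqWord h]
  | [], _ :: _, h => by simp [eqWord] at h
  | _ :: _, [], h => by simp [eqWord] at h

/-- Add a term to a combination, collecting equal words. -/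
def addTerm (p : ℤ × List ℕ) : Comb → Comb
  | [] => [p]
  | q :: L => bif eqWord p.2 q.2 then (p.1 + q.1, q.2) :: L else q :: addTerm p L

theorem evalComb_addTerm (f : List ℕ → N) (p : ℤ × List ℕ) (L : Comb) :
    evalComb f (addTerm p L) = p.1 • f p.2 + evalComb f L := by
  induction L with
  | nil => simp [addTerm, evalComb]
  | cons q L ih =>
    rw [addTerm, Bool.cond_eq_ite]
    split_ifs with h
    · rw [evalComb_cons, evalComb_cons, add_smul, eq_of_eqWord h, add_assoc]
    · rw [evalComb_cons, ih, evalComb_cons]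
      abel

/-- Collect equal words and delete the words with coefficient zero. -/
def collect (L : Comb) : Comb := (L.foldr addTerm []).filter fun p => p.1 != 0

theorem evalComb_collect (f : List ℕ → N) (L : Comb) : evalComb f (collect L) = evalComb f L := by
  have h1 : evalComb f (L.foldr addTerm []) = evalComb f L := by
    induction L with
    | nil => rfl
    | cons p L ih => rw [List.foldr_cons, evalComb_addTerm, ih, evalComb_cons]
  rw [← h1, collect]
  induction L.foldr addTerm [] with
  | nil => rfl
  | cons p L ih =>
    rw [List.filter_cons]
    split_ifs with h
    · rw [evalComb_cons, evalComb_cons, ih]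
    · have : p.1 = 0 := by simpa using h
      rw [ih, evalComb_cons, this, zero_smul, zero_add]

theorem mem_addTerm {p q : ℤ × List ℕ} {L : Comb} (h : q ∈ addTerm p L) :
    q.2 = p.2 ∨ ∃ q' ∈ L, q.2 = q'.2 := by
  induction L with
  | nil => left; simp only [addTerm, List.mem_singleton] at h; rw [h]
  | cons r L ih =>
    rw [addTerm, Bool.cond_eq_ite] at h
    split_ifs at h with hp
    · rcases List.mem_cons.1 h with rfl | h
      · exact Or.inr ⟨r, by simp, rfl⟩
      · exact Or.inr ⟨q, by simp [h], rfl⟩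
    · rcases List.mem_cons.1 h with rfl | h
      · exact Or.inr ⟨q, by simp, rfl⟩
      · rcases ih h with h | ⟨q', h', e⟩
        · exact Or.inl h
        · exact Or.inr ⟨q', by simp [h'], e⟩

theorem mem_collect {q : ℤ × List ℕ} {L : Comb} (h : q ∈ collect L) :
    ∃ p ∈ L, q.2 = p.2 := by
  have h' := List.mem_of_mem_filter h
  clear h
  induction L generalizing q with
  | nil => simp at h'
  | cons p L ih =>
    rcases mem_addTerm h' with h | ⟨q', hq', e⟩
    · exact ⟨p, by simp, h⟩
    · obtain ⟨p', hp', e'⟩ := ih hq'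
      exact ⟨p', by simp [hp'], e.trans e'⟩

/-- Exchange the letters `a` and `b`. -/
def swapLetter (a b c : ℕ) : ℕ := bif Nat.beq c a then b else bif Nat.beq c b then a else c

theorem swapLetter_eq (a b c : ℕ) :
    swapLetter a b c = if c = a then b else if c = b then a else c := by
  simp [swapLetter, Bool.cond_eq_ite]

/-- Replace the letter `a` by `b`. -/
def replaceLetter (a b c : ℕ) : ℕ := bif Nat.beq c a then b else c

theorem replaceLetter_eq (a b c : ℕ) : replaceLetter a b c = if c = a then b else c := by
  simp [replaceLetter, Bool.cond_eq_ite]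

/-- The first letter of a word in the interval from `a` to `7`, and `a` if there is none. -/
def firstFrom (a : ℕ) : List ℕ → ℕ
  | [] => a
  | c :: w => bif Nat.ble a c && Nat.ble c 7 then c else firstFrom a w

theorem firstFrom_spec (a : ℕ) (w : List ℕ) :
    firstFrom a w = a ∨ (a < firstFrom a w ∧ firstFrom a w ≤ 7) := by
  induction w with
  | nil => exact Or.inl rfl
  | cons c w ih =>
    rw [firstFrom, Bool.cond_eq_ite]
    split_ifs with h
    · simp only [Bool.and_eq_true, Nat.ble_eq] at h
      omega
    · exact ih

/-- Exchange `a` with the first letter of the word in the interval from `a` to `7`. -/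
def sortStep (p : ℤ × List ℕ) (a : ℕ) : ℤ × List ℕ :=
  bif Nat.beq (firstFrom a p.2) a then p
  else (-p.1, p.2.map (swapLetter a (firstFrom a p.2)))

/-- Sort the letters `a, …, 7` of a word, where `a` is the first entry of the list `[a, …, 6]`. -/
def sortTerm (l : List ℕ) (p : ℤ × List ℕ) : ℤ × List ℕ := l.foldl sortStep p

/-- The map `f` on words changes its sign when two of the letters from `a` to `7` are exchanged. -/
def Antisymmetric (f : List ℕ → N) (a : ℕ) : Prop :=
  ∀ b c, a ≤ b → b < c → c ≤ 7 → ∀ w, f (w.map (swapLetter b c)) = -f w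

/-- Each exchange made by the sorting changes the sign of the coefficient and of the value of f, so
the term is unchanged. -/
theorem sortTerm_smul {f : List ℕ → N} {a : ℕ} (hf : Antisymmetric f a) (l : List ℕ)
    (hl : ∀ b ∈ l, a ≤ b) (p : ℤ × List ℕ) :
    (sortTerm l p).1 • f (sortTerm l p).2 = p.1 • f p.2 := by
  induction l generalizing p with
  | nil => rfl
  | cons b l ih =>
    rw [sortTerm, List.foldl_cons]
    change (sortTerm l (sortStep p b)).1 • f (sortTerm l (sortStep p b)).2 = _
    rw [ih (fun b hb => hl b (by simp [hb])), sortStep, Bool.cond_eq_ite]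
    split_ifs with h
    · rfl
    · have hne : firstFrom b p.2 ≠ b := fun e => h (by rw [e]; exact Nat.beq_refl b)
      have hs := (firstFrom_spec b p.2).resolve_left hne
      simp only
      rw [hf b _ (hl b (by simp)) hs.1 hs.2, smul_neg, neg_smul, neg_neg]

theorem length_sortTerm (l : List ℕ) (p : ℤ × List ℕ) :
    (sortTerm l p).2.length = p.2.length := by
  induction l generalizing p with
  | nil => rfl
  | cons b l ih =>
    rw [sortTerm, List.foldl_cons]
    change (sortTerm l (sortStep p b)).2.length = _
    rw [ih, sortStep, Bool.cond_eq_ite]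
    split_ifs <;> simp

/-- Sort the letters `a, …, 7` in all words of a combination and collect. -/
def normalize (a : ℕ) (L : Comb) : Comb := collect (L.map (sortTerm (List.range' a (7 - a))))

/-- Only preservation of the value is needed: an empty result certifies vanishing, and no uniqueness
of normal forms is used. -/
theorem evalComb_normalize {f : List ℕ → N} {a : ℕ} (hf : Antisymmetric f a) (L : Comb) :
    evalComb f (normalize a L) = evalComb f L := by
  rw [normalize, evalComb_collect]
  exact evalComb_map_congr fun p _ =>
    sortTerm_smul hf _ (fun b hb => (List.mem_range'_1.1 hb).1) p

theorem length_normalize {n a : ℕ} {L : Comb} (hL : ∀ p ∈ L, p.2.length = n) :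
    ∀ p ∈ normalize a L, p.2.length = n := fun p hp => by
  obtain ⟨q, hq, e⟩ := mem_collect hp
  obtain ⟨q', hq', rfl⟩ := List.mem_map.1 hq
  rw [e, length_sortTerm, hL q' hq']

end Comb

/-! ## Words for the vector `v_{[3,1^5]}` -/

section Words

variable {g : ℕ}

/-- The vector denoted by a letter: `0` and `1` stand for the two factors of `ω`, the letters
`2, …, 7` for the factors of the wedge product, permuted by `σ`, all others for `e_1`. -/
def letterVec (x y : H g) (σ : Equiv.Perm (Fin 6)) (c : ℕ) : H g :=
  if c = 0 then x else if c = 1 then y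
  else if h : c - 2 < 6 then e g ((σ ⟨c - 2, h⟩).val + 1) else e g 1

/-- The permutations of the six wedge factors that fix the first one. -/
def stabPerm : Finset (Equiv.Perm (Fin 6)) := Finset.univ.filter fun σ => σ 0 = 0

/-- The tensor of a word, antisymmetrized over a set of permutations of the letters `2, …, 7`. -/
def altWord (S : Finset (Equiv.Perm (Fin 6))) (n : ℕ) (x y : H g) (w : List ℕ) : ⨂[ℚ]^n (H g) :=
  ∑ σ ∈ S, (Equiv.Perm.sign σ : ℤ) • tens n (w.map (letterVec x y σ))

theorem letterVec_swapLetter (x y : H g) (σ : Equiv.Perm (Fin 6)) (a b : Fin 6) (c : ℕ) :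
    letterVec x y σ (swapLetter (a + 2) (b + 2) c) =
      letterVec x y (σ * Equiv.swap a b) c := by
  simp only [letterVec, swapLetter_eq, Equiv.Perm.mul_apply]
  by_cases h0 : c = 0
  · subst h0; simp
  by_cases h1 : c = 1
  · subst h1; simp
  by_cases hc : c - 2 < 6
  · obtain ⟨d, rfl⟩ : ∃ d : Fin 6, c = d + 2 := ⟨⟨c - 2, hc⟩, by simp only; omega⟩
    simp only [Nat.add_right_cancel_iff, ← Fin.ext_iff, Equiv.swap_apply_def]
    split_ifs <;> simp_all
  · have ha : c ≠ a + 2 := by omega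
    have hb : c ≠ b + 2 := by omega
    simp [h0, h1, hc, ha, hb]

/-- Exchanging two wedge letters amounts to reindexing the sum by σ ↦ σ (a b), which reverses the
sign. -/
theorem altWord_swap {S : Finset (Equiv.Perm (Fin 6))} (n : ℕ) (x y : H g) {a b : Fin 6}
    (hab : a ≠ b) (hS : ∀ σ ∈ S, σ * Equiv.swap a b ∈ S) (w : List ℕ) :
    altWord S n x y (w.map (swapLetter (a + 2) (b + 2))) = -altWord S n x y w := by
  rw [altWord, altWord, ← Finset.sum_neg_distrib]
  refine Finset.sum_nbij' (fun σ => σ * Equiv.swap a b) (fun σ => σ * Equiv.swap a b) hS hS ?_ ?_ ?_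
  · intro σ _; simp [mul_assoc]
  · intro σ _; simp [mul_assoc]
  · intro σ _
    rw [List.map_map, ← neg_smul, Equiv.Perm.sign_mul, Equiv.Perm.sign_swap hab]
    simp only [Function.comp_def, letterVec_swapLetter]
    simp

theorem altWord_univ_antisymmetric (n : ℕ) (x y : H g) :
    Antisymmetric (altWord Finset.univ n x y) 2 := by
  intro b c hb hbc hc w
  have := altWord_swap (S := Finset.univ) n x y (a := ⟨b - 2, by omega⟩) (b := ⟨c - 2, by omega⟩)
    (by simp only [ne_eq, Fin.ext_iff]; omega) (fun σ _ => Finset.mem_univ _) w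
  simp only [Nat.sub_add_cancel hb, Nat.sub_add_cancel (show 2 ≤ c by omega)] at this
  exact this

/-- Antisymmetry starts at letter 3 because letter 2, the first wedge factor, is now fixed. -/
theorem altWord_stabPerm_antisymmetric (n : ℕ) (x y : H g) :
    Antisymmetric (altWord stabPerm n x y) 3 := by
  intro b c hb hbc hc w
  have := altWord_swap (S := stabPerm) n x y (a := ⟨b - 2, by omega⟩) (b := ⟨c - 2, by omega⟩)
    (by simp only [ne_eq, Fin.ext_iff]; omega) (fun σ hσ => by
      have h0 : σ 0 = 0 := by simpa [stabPerm] using hσ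
      have hb0 : (0 : Fin 6) ≠ ⟨b - 2, by omega⟩ := by simp only [ne_eq, Fin.ext_iff]; simp; omega
      have hc0 : (0 : Fin 6) ≠ ⟨c - 2, by omega⟩ := by simp only [ne_eq, Fin.ext_iff]; simp; omega
      simp [stabPerm, Equiv.swap_apply_of_ne_of_ne hb0 hc0, h0]) w
  simp only [Nat.sub_add_cancel (show 2 ≤ b by omega),
    Nat.sub_add_cancel (show 2 ≤ c by omega)] at this
  exact this

/-- When σ fixes the first wedge factor, the letters 2 and 8 both denote e_1. -/
theorem altWord_stabPerm_replaceLetter (n : ℕ) (x y : H g) (w : List ℕ) :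
    altWord stabPerm n x y (w.map (replaceLetter 2 8)) = altWord stabPerm n x y w := by
  refine Finset.sum_congr rfl fun σ hσ => ?_
  have h0 : σ 0 = 0 := by simpa [stabPerm] using hσ
  rw [List.map_map]
  congr 3
  ext1 c
  simp only [Function.comp_apply, replaceLetter_eq]
  split_ifs with h
  · subst h; simp [letterVec, h0]
  · rfl

theorem Antisymmetric.map {N N' : Type*} [AddCommGroup N] [AddCommGroup N'] (φ : N →+ N')
    {f : List ℕ → N} {a : ℕ} (h : Antisymmetric f a) : Antisymmetric (fun w => φ (f w)) a :=
  fun b c hb hbc hc w => by simp only [h b c hb hbc hc w, map_neg]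

/-- The symmetric group is split into cosets of the stabilizer of 0; the coset of σ is determined by
the preimage t of 0 under σ, with representative the transposition (0 t). -/
theorem sum_perm_eq {N : Type*} [AddCommMonoid N] (F : Equiv.Perm (Fin 6) → N) :
    ∑ σ, F σ = ∑ t : Fin 6, ∑ σ ∈ stabPerm, F (σ * Equiv.swap 0 t) := by
  rw [← Finset.sum_fiberwise Finset.univ (fun σ : Equiv.Perm (Fin 6) => σ⁻¹ 0) F]
  refine Finset.sum_congr rfl fun t _ => ?_
  refine Finset.sum_nbij' (fun σ => σ * Equiv.swap 0 t) (fun σ => σ * Equiv.swap 0 t) ?_ ?_ ?_ ?_ ?_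
  · intro σ hσ
    have h : σ⁻¹ 0 = t := by simpa using hσ
    simp [stabPerm, ← h]
  · intro σ hσ
    have h : σ 0 = 0 := by simpa [stabPerm] using hσ
    simp only [Finset.mem_filter, Finset.mem_univ, true_and, Equiv.Perm.inv_eq_iff_eq]
    simp [h]
  · intro σ _; simp [mul_assoc]
  · intro σ _; simp [mul_assoc]
  · intro σ _; simp [mul_assoc]

/-- Expand the antisymmetrization of a word according to the place of `e_1` in the wedge product. -/
def expandWord (w : List ℕ) : Comb :=
  (1, w.map (replaceLetter 2 8)) ::
    (List.range 5).map fun t => (-1, (w.map (swapLetter 2 (t + 3))).map (replaceLetter 2 8))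

/-- This exposes the relations between words caused by e_1 occurring both in the wedge and in the
last two factors of the hook vector, which sorting letters 2, …, 7 cannot see. -/
theorem altWord_univ_eq (n : ℕ) (x y : H g) (w : List ℕ) :
    altWord Finset.univ n x y w = evalComb (altWord stabPerm n x y) (expandWord w) := by
  rw [altWord, sum_perm_eq]
  have h : ∀ t : Fin 6, ∑ σ ∈ stabPerm, (Equiv.Perm.sign (σ * Equiv.swap 0 t) : ℤ) •
      tens n (w.map (letterVec x y (σ * Equiv.swap 0 t))) =
      (if t = 0 then 1 else -1 : ℤ) •
        altWord stabPerm n x y (w.map (swapLetter 2 (t + 2))) := fun t => by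
    rw [altWord, Finset.smul_sum]
    refine Finset.sum_congr rfl fun σ _ => ?_
    have e : w.map (letterVec x y (σ * Equiv.swap 0 t)) =
        (w.map (swapLetter 2 (t + 2))).map (letterVec x y σ) := by
      rw [List.map_map]
      exact List.map_congr_left fun c _ => (letterVec_swapLetter x y σ 0 t c).symm
    rw [e, smul_smul, Equiv.Perm.sign_mul]
    congr 1
    split_ifs with ht
    · simp [ht]
    · rw [Equiv.Perm.sign_swap (Ne.symm ht)]; simp
  have h2 : w.map (swapLetter 2 2) = w := by
    conv_rhs => rw [← List.map_id w]
    refine List.map_congr_left fun c _ => ?_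
    simp only [swapLetter_eq, id]
    split_ifs with h <;> simp [h]
  simp_rw [h]
  rw [evalComb, expandWord, show List.range 5 = [0, 1, 2, 3, 4] from rfl]
  simp only [List.map_cons, List.map_nil, altWord_stabPerm_replaceLetter]
  obtain ⟨G, hG⟩ : ∃ G : ℕ → ⨂[ℚ]^n (H g), ∀ t, altWord stabPerm n x y (w.map (swapLetter 2 t)) =
    G t := ⟨_, fun _ => rfl⟩
  have h0 : altWord stabPerm n x y w = G 2 := by rw [← hG, h2]
  simp only [hG, h0, Fin.sum_univ_succ]
  simp

/-- The tensor of a word of ten letters, summed over `ω`. -/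
def hookWord (g : ℕ) (w : List ℕ) : ⨂[ℚ]^10 (H g) :=
  ∑ r ∈ Finset.Icc 1 (2 * g), altWord Finset.univ 10 (e g r) (eStar g r) w

theorem hookWord_antisymmetric : Antisymmetric (hookWord g) 2 := fun b c hb hbc hc w => by
  simp only [hookWord, altWord_univ_antisymmetric _ _ _ b c hb hbc hc w, Finset.sum_neg_distrib]

theorem vHook_eq (g : ℕ) : vHook g = hookWord g [0, 1, 2, 3, 4, 5, 6, 7, 8, 8] := by
  refine Finset.sum_congr rfl fun r _ => Finset.sum_congr rfl fun σ _ => ?_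
  refine (Int.cast_smul_eq_zsmul ℚ (M := ⨂[ℚ]^10 (H g)) _ _).trans ?_
  rw [tens]
  congr 2
  ext1 i
  fin_cases i <;> rfl

end Words

/-! ## The vector `v_{[3,1^5]} θ ζ_{10}` as a combination of words -/

section Expansion

variable {g : ℕ}

theorem moveToFront_map {α β : Type*} (f : α → β) (m : ℕ) (l : List α) :
    moveToFront m (l.map f) = (moveToFront m l).map f := by
  simp [moveToFront, List.map_take, List.map_drop]

theorem place_sProd_hookWord {m : ℕ} (hm : m < 8) {w : List ℕ} (hw : w.length = 10) :
    place g 10 (sProd (m + 1)) (hookWord g w) = hookWord g (moveToFront m w) := by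
  simp only [hookWord, altWord, map_sum, map_zsmul]
  refine Finset.sum_congr rfl fun r _ => Finset.sum_congr rfl fun σ _ => ?_
  rw [place_sProd_tens hm _ (by simpa using hw), moveToFront_map]

theorem place_finRotate_pow_tens {n : ℕ} (i : ℕ) (l : List (H g)) (hl : l.length = n) :
    place g n (finRotate n ^ i) (tens n l) = tens n (l.rotate i) := by
  rw [place_tens, ofFn_finRotate_pow fun k : Fin n => l.getD k 0]
  congr 2
  refine List.ext_getElem (by simp [hl]) fun k h₁ h₂ => ?_
  simp [h₂]

theorem place_finRotate_pow_hookWord (i : ℕ) {w : List ℕ} (hw : w.length = 10) :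
    place g 10 (finRotate 10 ^ i) (hookWord g w) = hookWord g (w.rotate i) := by
  simp only [hookWord, altWord, map_sum, map_zsmul]
  refine Finset.sum_congr rfl fun r _ => Finset.sum_congr rfl fun σ _ => ?_
  rw [place_finRotate_pow_tens i _ (by simpa using hw), List.map_rotate]

/-- The action of one factor of `θ` on combinations of words. -/
def thetaStep (L : Comb) (m : ℕ) : Comb :=
  normalize 2 (L ++ L.map fun p => (-p.1, moveToFront m p.2))

/-- Normalizing after every factor collects equal words before the next doubling. -/
theorem evalComb_thetaStep {m : ℕ} (hm : m < 8) {L : Comb} (hL : ∀ p ∈ L, p.2.length = 10) :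
    evalComb (hookWord g) (thetaStep L m) = act (evalComb (hookWord g) L)
      (1 - MonoidAlgebra.of ℚ (Equiv.Perm (Fin 10)) (sProd (m + 1))) := by
  rw [thetaStep, evalComb_normalize hookWord_antisymmetric, evalComb_append, act_sub, act_one,
    act_of, sub_eq_add_neg]
  congr 1
  have h := map_evalComb (place g 10 (sProd (m + 1))).toAddMonoidHom (hookWord g) L
  simp only [LinearMap.toAddMonoidHom_coe] at h
  rw [h, ← neg_one_zsmul, ← evalComb_smulComb]
  rw [smulComb]
  rw [evalComb, evalComb, List.map_map, List.map_map]
  refine congrArg List.sum (List.map_congr_left fun p hp => ?_)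
  simp [place_sProd_hookWord hm (hL p hp)]

theorem length_thetaStep {m : ℕ} (hm : m < 8) {L : Comb} (hL : ∀ p ∈ L, p.2.length = 10) :
    ∀ p ∈ thetaStep L m, p.2.length = 10 := by
  refine length_normalize fun p hp => ?_
  rcases List.mem_append.1 hp with hp | hp
  · exact hL p hp
  · obtain ⟨q, hq, rfl⟩ := List.mem_map.1 hp
    exact length_moveToFront hm _ (hL q hq)

/-- The word of `v_{[3,1^5]}`. -/
def hookComb : Comb := [(1, [0, 1, 2, 3, 4, 5, 6, 7, 8, 8])]

/-- `v_{[3,1^5]} θ` as a combination of words. -/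
def thetaComb : Comb := (List.range 8).foldl thetaStep hookComb

theorem evalComb_foldl_thetaStep (l : List ℕ) (hl : ∀ m ∈ l, m < 8) (L : Comb)
    (hL : ∀ p ∈ L, p.2.length = 10) :
    evalComb (hookWord g) (l.foldl thetaStep L) = act (evalComb (hookWord g) L)
      (l.map fun m => 1 - MonoidAlgebra.of ℚ (Equiv.Perm (Fin 10)) (sProd (m + 1))).prod ∧
    ∀ p ∈ l.foldl thetaStep L, p.2.length = 10 := by
  induction l generalizing L with
  | nil => exact ⟨by simp [act_one], hL⟩
  | cons m l ih =>
    have hm : m < 8 := hl m (by simp)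
    rw [List.foldl_cons, List.map_cons, List.prod_cons, act_mul, ← evalComb_thetaStep hm hL]
    exact ih (fun m hm => hl m (by simp [hm])) _ (length_thetaStep hm hL)

theorem length_hookComb : ∀ p ∈ hookComb, p.2.length = 10 := by simp [hookComb]

theorem evalComb_thetaComb : evalComb (hookWord g) thetaComb = act (vHook g) theta := by
  have h : vHook g = evalComb (hookWord g) hookComb := by simp [vHook_eq, evalComb, hookComb]
  rw [h]
  exact (evalComb_foldl_thetaStep _ (by simp) _ length_hookComb).1

theorem length_thetaComb : ∀ p ∈ thetaComb, p.2.length = 10 :=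
  -- The words do not depend on g, so any value of g serves to read off their lengths.
  (evalComb_foldl_thetaStep (g := 0) _ (by simp) _ length_hookComb).2

/-- `v_{[3,1^5]} θ ζ_{10}` as a combination of words. -/
def zetaComb : Comb :=
  bindComb thetaComb fun w => (List.range 10).map fun i => (1, w.drop i ++ w.take i)

theorem evalComb_zetaComb : evalComb (hookWord g) zetaComb = vThetaZeta g := by
  rw [zetaComb, evalComb_bindComb, vThetaZeta, act_zeta, ← evalComb_thetaComb]
  have h : ∀ i, place g 10 (finRotate 10 ^ i) (evalComb (hookWord g) thetaComb) =
      evalComb (fun w => hookWord g (w.rotate i)) thetaComb := fun i => by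
    have h := map_evalComb (place g 10 (finRotate 10 ^ i)).toAddMonoidHom (hookWord g) thetaComb
    simp only [LinearMap.toAddMonoidHom_coe] at h
    rw [h]
    exact evalComb_congr fun p hp => place_finRotate_pow_hookWord i (length_thetaComb p hp)
  simp_rw [h]
  rw [← evalComb_finset_sum]
  refine evalComb_congr fun p hp => ?_
  have hr : ∀ i ∈ Finset.range 10, hookWord g (p.2.rotate i) =
      hookWord g (p.2.drop i ++ p.2.take i) := fun i hi => by
    rw [List.rotate_eq_drop_append_take]
    rw [length_thetaComb p hp]
    exact (Finset.mem_range.1 hi).le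
  rw [Finset.sum_congr rfl hr]
  simp only [evalComb, List.map_map, Function.comp_def, one_smul]
  rfl

end Expansion

/-! ## Contractions of words -/

/-- The words that arise when the places `0` and `l` hold both letters of `ω`. -/
def loopPart (l : ℕ) : List ℕ → Comb
  | [] => []
  | a :: t =>
    let b := t.getD (l - 1) 0
    let rest := t.take (l - 1) ++ t.drop l
    if a = 0 ∧ b = 1 then [(1, rest)] else if a = 1 ∧ b = 0 then [(-1, rest)] else []

/-- The words that arise when exactly one of the places `0` and `l` holds a letter of `ω`. -/
def crossPart (l : ℕ) : List ℕ → Comb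
  | [] => []
  | a :: t =>
    let b := t.getD (l - 1) 0
    let rest := t.take (l - 1) ++ t.drop l
    if a = 0 then if b = 1 then [] else [(1, rest.map (replaceLetter 1 b))]
    else if a = 1 then if b = 0 then [] else [(-1, rest.map (replaceLetter 0 b))]
    else if b = 0 then [(-1, rest.map (replaceLetter 1 a))]
    else if b = 1 then [(1, rest.map (replaceLetter 0 a))] else []

/-- All pairs of rotations of the first `l - 1` and of the remaining letters of a word. -/
def rotations (l : ℕ) (w : List ℕ) : Comb :=
  (List.range (l - 1)).flatMap fun i => (List.range (9 - l)).map fun j =>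
    (1, ((w.take (l - 1)).drop i ++ (w.take (l - 1)).take i) ++
      ((w.drop (l - 1)).drop j ++ (w.drop (l - 1)).take j))

/-- A word of ten letters in which `0` and `1` occur exactly once. -/
def goodWord (w : List ℕ) : Bool := w.length == 10 && w.count 0 == 1 && w.count 1 == 1

/-- Since each factor of ω occurs once, every tensor is linear in e_r and in its dual separately, so
that contractions can be summed over r. -/
theorem zetaComb_good : zetaComb.all (fun p => goodWord p.2) = true := by
  decide +kernel

/-- After averaging over rotations, the terms with a contraction inside `ω` vanish. -/
theorem loopPart_vanishes (l : ℕ) (h2 : 2 ≤ l) (h8 : l ≤ 8) :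
    (normalize 3 (bindComb (bindComb (normalize 2 (bindComb zetaComb (loopPart l))) expandWord)
      (rotations l))).isEmpty = true := by
  -- The list is 2, …, 8. The wedge is expanded by the place of e_1 before the rotations are
  -- applied, so that words differing only in which copy of e_1 stands where can cancel.
  have h : ((List.range' 2 7).all fun l => (normalize 3 (bindComb (bindComb (normalize 2
      (bindComb zetaComb (loopPart l))) expandWord) (rotations l))).isEmpty) = true := by
    decide +kernel
  exact List.all_eq_true.1 h l (List.mem_range'_1.2 (by omega))

/-- After averaging over rotations, the terms with a contraction outside `ω` vanish. -/
theorem crossPart_vanishes (l : ℕ) (h2 : 2 ≤ l) (h8 : l ≤ 8) :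
    (normalize 2 (bindComb (normalize 2 (bindComb zetaComb (crossPart l)))
      (rotations l))).isEmpty = true := by
  -- These terms cancel already with the wedge's e_1 kept apart from the letter 8, so no expansion
  -- is made.
  have h : ((List.range' 2 7).all fun l => (normalize 2 (bindComb (normalize 2
      (bindComb zetaComb (crossPart l))) (rotations l))).isEmpty) = true := by
    decide +kernel
  exact List.all_eq_true.1 h l (List.mem_range'_1.2 (by omega))

/-! ## Contractions of the tensor `ω` -/

section Omega

variable {g : ℕ}

theorem form_single (r : Fin (2 * g)) (y : H g) :
    form g (Pi.single r 1) y = (J g).mulVec y r := by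
  simp [form, Matrix.toBilin'_apply']

theorem form_row (r : Fin (2 * g)) (y : H g) : form g (J g r) y = -y r := by
  have h : form g (J g r) y = (J g).mulVec ((J g).mulVec y) r := by
    simp only [form, Matrix.toBilin'_apply']
    rfl
  rw [h, Matrix.mulVec_mulVec, J_mul_J, Matrix.neg_mulVec, Matrix.one_mulVec]
  rfl

theorem form_e_eStar {r : ℕ} (hr : r ∈ Finset.Icc 1 (2 * g)) :
    form g (e g r) (eStar g r) = 1 := by
  obtain ⟨h1, h2⟩ := Finset.mem_Icc.1 hr
  obtain ⟨s, rfl⟩ : ∃ s : Fin (2 * g), r = s.val + 1 := ⟨⟨r - 1, by omega⟩, by simp only; omega⟩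
  rw [eStar_succ, e_succ_eq_single, form_swap, form_row]
  simp

/-- The vectors e_r and their duals are dual bases for the form; in matrices this is ᵗJ J = 1. -/
theorem sum_form_e_smul (y : H g) :
    ∑ r ∈ Finset.Icc 1 (2 * g), form g (e g r) y • eStar g r = y := by
  rw [sum_Icc_eq_sum_fin]
  simp_rw [e_succ_eq_single, eStar_succ, form_single]
  have h : ((J g).transpose * J g).mulVec y = y := by
    rw [J_transpose, neg_mul, J_mul_J, neg_neg, Matrix.one_mulVec]
  conv_rhs => rw [← h]
  ext j
  rw [← Matrix.mulVec_mulVec, Finset.sum_apply]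
  simp only [Matrix.mulVec, dotProduct, Pi.smul_apply, smul_eq_mul, Matrix.transpose_apply]
  exact Finset.sum_congr rfl fun r _ => mul_comm _ _

theorem sum_form_eStar_smul (y : H g) :
    ∑ r ∈ Finset.Icc 1 (2 * g), form g (eStar g r) y • e g r = -y := by
  rw [sum_Icc_eq_sum_fin]
  simp_rw [e_succ_eq_single, eStar_succ, form_row]
  conv_rhs => rw [pi_eq_sum_univ' y]
  simp

theorem form_e_e {a b : ℕ} (ha : 1 ≤ a) (ha' : a ≤ g) (hb' : b ≤ g) :
    form g (e g a) (e g b) = 0 := by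
  obtain ⟨s, rfl⟩ : ∃ s : Fin (2 * g), a = s.val + 1 := ⟨⟨a - 1, by omega⟩, by simp only; omega⟩
  rw [e_succ_eq_single, form_single, Matrix.mulVec, dotProduct]
  refine Finset.sum_eq_zero fun j _ => ?_
  simp only [J, e, Fin.ext_iff, Fin.val_rev]
  split_ifs <;> first | omega | simp

theorem exists_letterVec_eq (x y : H g) (σ : Equiv.Perm (Fin 6)) {c : ℕ} (hc : 2 ≤ c) :
    ∃ a, 1 ≤ a ∧ a ≤ 6 ∧ letterVec x y σ c = e g a := by
  have h0 : c ≠ 0 := by omega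
  have h1 : c ≠ 1 := by omega
  by_cases h : c - 2 < 6
  · exact ⟨σ ⟨c - 2, h⟩ + 1, by omega, by omega, by simp [letterVec, h0, h1, h]⟩
  · exact ⟨1, by omega, by omega, by simp [letterVec, h0, h1, h]⟩

theorem form_letterVec (hg : 6 ≤ g) (x y x' y' : H g) (σ : Equiv.Perm (Fin 6)) {c d : ℕ}
    (hc : 2 ≤ c) (hd : 2 ≤ d) : form g (letterVec x y σ c) (letterVec x' y' σ d) = 0 := by
  obtain ⟨a, h1, h2, h3⟩ := exists_letterVec_eq x y σ hc
  obtain ⟨b, h1', h2', h3'⟩ := exists_letterVec_eq x' y' σ hd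
  rw [h3, h3', form_e_e h1 (by omega) (by omega)]

theorem letterVec_congr {x y x' y' : H g} {σ : Equiv.Perm (Fin 6)} {c : ℕ}
    (h0 : c = 0 → x = x') (h1 : c = 1 → y = y') :
    letterVec x y σ c = letterVec x' y' σ c := by
  simp only [letterVec]
  split_ifs with h h' <;> simp_all

/-- The tensor of a list depends linearly on each entry. -/
theorem exists_linear_tens (n : ℕ) (u v : List (H g)) (hu : u.length < n) :
    ∃ F : H g →ₗ[ℚ] ⨂[ℚ]^n (H g), ∀ y, tens n (u ++ y :: v) = F y := by
  refine ⟨(PiTensorProduct.tprod ℚ).toLinearMap (fun i : Fin n => (u ++ 0 :: v).getD i 0)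
    ⟨u.length, hu⟩, fun y => ?_⟩
  rw [MultilinearMap.toLinearMap_apply, tens]
  congr 1
  ext1 i
  by_cases hi : i = ⟨u.length, hu⟩
  · subst hi; simp
  · have hne : i.val ≠ u.length := fun h => hi (Fin.ext h)
    rw [Function.update_of_ne hi]
    rcases lt_or_gt_of_ne hne with h | h
    · simp [List.getElem?_append_left h]
    · obtain ⟨d, hd⟩ : ∃ d, i.val - u.length = d + 1 := ⟨i.val - u.length - 1, by omega⟩
      simp [List.getElem?_append_right h.le, hd]

theorem exists_split_of_count {c : ℕ} {w : List ℕ} (h : w.count c = 1) :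
    ∃ u v, w = u ++ c :: v ∧ c ∉ u ∧ c ∉ v := by
  have hc : c ∈ w := List.count_pos_iff.1 (by omega)
  obtain ⟨u, v, rfl⟩ := List.append_of_mem hc
  simp only [List.count_append, List.count_cons_self] at h
  exact ⟨u, v, rfl, List.count_eq_zero.1 (by omega), List.count_eq_zero.1 (by omega)⟩

/-- The word contains 1 once, so its tensor is linear in the dual vector there and the dual basis
identity inserts y. The vector x is arbitrary because the letter 0 is absent. -/
theorem sum_form_e_tens {n : ℕ} (σ : Equiv.Perm (Fin 6)) {w : List ℕ} (hn : w.length ≤ n)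
    (h0 : w.count 0 = 0) (h1 : w.count 1 = 1) (x y : H g) :
    ∑ r ∈ Finset.Icc 1 (2 * g), form g (e g r) y •
      tens n (w.map (letterVec (e g r) (eStar g r) σ)) = tens n (w.map (letterVec x y σ)) := by
  obtain ⟨u, v, rfl, hu, hv⟩ := exists_split_of_count h1
  have h0u : (0 : ℕ) ∉ u ++ 1 :: v := List.count_eq_zero.1 h0
  simp only [List.mem_append, List.mem_cons, not_or] at h0u
  have hmap : ∀ x' y' : H g, (u ++ 1 :: v).map (letterVec x' y' σ) =
      u.map (letterVec 0 0 σ) ++ y' :: v.map (letterVec 0 0 σ) := fun x' y' => by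
    rw [List.map_append, List.map_cons]
    congr 1
    · refine List.map_congr_left fun c hc => letterVec_congr ?_ ?_
      · rintro rfl; exact absurd hc h0u.1
      · rintro rfl; exact absurd hc hu
    · congr 1
      refine List.map_congr_left fun c hc => letterVec_congr ?_ ?_
      · rintro rfl; exact absurd hc h0u.2.2
      · rintro rfl; exact absurd hc hv
  obtain ⟨F, hF⟩ := exists_linear_tens n (u.map (letterVec 0 0 σ)) (v.map (letterVec 0 0 σ))
    (by simp at hn ⊢; omega)
  have hT : ∀ x' y' : H g, tens n ((u ++ 1 :: v).map (letterVec x' y' σ)) = F y' :=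
    fun x' y' => by rw [hmap, hF]
  simp only [hT, ← map_smul, ← map_sum]
  rw [sum_form_e_smul]

theorem sum_form_eStar_tens {n : ℕ} (σ : Equiv.Perm (Fin 6)) {w : List ℕ} (hn : w.length ≤ n)
    (h0 : w.count 0 = 1) (h1 : w.count 1 = 0) (x y : H g) :
    ∑ r ∈ Finset.Icc 1 (2 * g), form g (eStar g r) x •
      tens n (w.map (letterVec (e g r) (eStar g r) σ)) = -tens n (w.map (letterVec x y σ)) := by
  obtain ⟨u, v, rfl, hu, hv⟩ := exists_split_of_count h0
  have h1u : (1 : ℕ) ∉ u ++ 0 :: v := List.count_eq_zero.1 h1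
  simp only [List.mem_append, List.mem_cons, not_or] at h1u
  have hmap : ∀ x' y' : H g, (u ++ 0 :: v).map (letterVec x' y' σ) =
      u.map (letterVec 0 0 σ) ++ x' :: v.map (letterVec 0 0 σ) := fun x' y' => by
    rw [List.map_append, List.map_cons]
    congr 1
    · refine List.map_congr_left fun c hc => letterVec_congr ?_ ?_
      · rintro rfl; exact absurd hc hu
      · rintro rfl; exact absurd hc h1u.1
    · congr 1
      refine List.map_congr_left fun c hc => letterVec_congr ?_ ?_
      · rintro rfl; exact absurd hc hv
      · rintro rfl; exact absurd hc h1u.2.2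
  obtain ⟨F, hF⟩ := exists_linear_tens n (u.map (letterVec 0 0 σ)) (v.map (letterVec 0 0 σ))
    (by simp at hn ⊢; omega)
  have hT : ∀ x' y' : H g, tens n ((u ++ 0 :: v).map (letterVec x' y' σ)) = F x' :=
    fun x' y' => by rw [hmap, hF]
  simp only [hT, ← map_smul, ← map_sum]
  rw [sum_form_eStar_smul, map_neg]

end Omega

/-! ## The maps `Θ_ℓ` on words -/

section ThetaWords

variable {g : ℕ}

theorem Theta_tens {l : ℕ} (h1 : 1 ≤ l) (h2 : l ≤ 9) (hl : l - 1 + (8 + 1 - l) = 8) (a b : H g)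
    {u v : List (H g)} (hu : u.length = l - 1) :
    Theta g 8 l h1 h2 (tens 10 (a :: (u ++ b :: v))) =
      form g a b • varpi g hl (tens 8 (u ++ v)) := by
  rw [← map_smul]
  change varpi g hl (Phi g 8 l h1 h2 (tens 10 (a :: (u ++ b :: v)))) = _
  congr 1
  rw [tens, Phi, contract_tprod]
  congr 1
  · simp [hu]
  · rw [tens]
    congr 1
    ext1 t
    simp only [Fin.succAbove, Fin.lt_def, Fin.val_castSucc, apply_ite Fin.val, Fin.val_succ]
    split_ifs with h
    · simp [List.getElem?_append_left (show t.val < u.length by omega)]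
    · obtain ⟨d, hd⟩ : ∃ d, t.val = u.length + d := ⟨t.val - u.length, by omega⟩
      rw [List.getD_cons_succ, hd, show u.length + d + 1 = u.length + (d + 1) from rfl,
        List.getD_eq_getElem?_getD, List.getD_eq_getElem?_getD,
        List.getElem?_append_right (by omega), List.getElem?_append_right (by omega)]
      simp

/-- The cases are the possible letters at the contracted places. Two factors of ω pair to ±1 for
each r, giving ±2g; a single factor transfers its partner vector to the place of the other factor;
two remaining letters denote orthogonal vectors. No factor of ω is left, so zero vectors may stand
for the letters 0 and 1. -/
theorem sum_form_letterVec (hg : 6 ≤ g) (σ : Equiv.Perm (Fin 6)) {a b l : ℕ} {u v : List ℕ}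
    (hu : u.length = l - 1) (hl : 1 ≤ l) (hn : (u ++ v).length = 8)
    (h0 : (a :: (u ++ b :: v)).count 0 = 1) (h1 : (a :: (u ++ b :: v)).count 1 = 1) :
    ∑ r ∈ Finset.Icc 1 (2 * g), form g (letterVec (e g r) (eStar g r) σ a)
        (letterVec (e g r) (eStar g r) σ b) •
      tens 8 ((u ++ v).map (letterVec (e g r) (eStar g r) σ)) =
      ((2 * g : ℕ) : ℤ) • evalComb (fun w => tens 8 (w.map (letterVec (0 : H g) 0 σ)))
        (loopPart l (a :: (u ++ b :: v))) +
      evalComb (fun w => tens 8 (w.map (letterVec (0 : H g) 0 σ)))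
        (crossPart l (a :: (u ++ b :: v))) := by
  have hb : (u ++ b :: v).getD (l - 1) 0 = b := by simp [← hu]
  have ht : (u ++ b :: v).take (l - 1) = u := List.take_left' hu
  have hd : (u ++ b :: v).drop l = v := by
    rw [show l = u.length + 1 by omega, ← List.drop_drop, List.drop_left]
    rfl
  simp only [loopPart, crossPart, hb, ht, hd]
  have hc0 : (u ++ v).count 0 + (if a = 0 then 1 else 0) + (if b = 0 then 1 else 0) = 1 := by
    simp only [List.count_cons, List.count_append, beq_iff_eq] at h0 ⊢
    omega
  have hc1 : (u ++ v).count 1 + (if a = 1 then 1 else 0) + (if b = 1 then 1 else 0) = 1 := by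
    simp only [List.count_cons, List.count_append, beq_iff_eq] at h1 ⊢
    omega
  generalize u ++ v = w at *
  have hconst : ∀ {c : ℕ}, 2 ≤ c → ∀ x y : H g, letterVec x y σ c = letterVec 0 0 σ c :=
    fun {c} hc x y => letterVec_congr (by omega) (by omega)
  have hzero : ∀ x y : H g, letterVec x y σ 0 = x := fun x y => by simp [letterVec]
  have hone : ∀ x y : H g, letterVec x y σ 1 = y := fun x y => by simp [letterVec]
  have hloop : w.count 0 = 0 → w.count 1 = 0 → ∀ x y : H g,
      w.map (letterVec x y σ) = w.map (letterVec 0 0 σ) := fun h h' x y =>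
    List.map_congr_left fun c hc => letterVec_congr
      (by rintro rfl; exact absurd hc (List.count_eq_zero.1 h))
      (by rintro rfl; exact absurd hc (List.count_eq_zero.1 h'))
  have hcrossE : w.count 0 = 0 → w.count 1 = 1 → ∀ c, 2 ≤ c →
      ∑ r ∈ Finset.Icc 1 (2 * g), form g (e g r) (letterVec 0 0 σ c) •
        tens 8 (w.map (letterVec (e g r) (eStar g r) σ)) =
      tens 8 ((w.map (replaceLetter 1 c)).map (letterVec (0 : H g) 0 σ)) := fun h h' c hc => by
    rw [sum_form_e_tens σ hn.le h h' 0, List.map_map]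
    congr 1
    refine List.map_congr_left fun d _ => ?_
    simp only [Function.comp_apply, replaceLetter_eq]
    split_ifs with hd1
    · subst hd1; rw [hone]
    · exact letterVec_congr (fun _ => rfl) (fun h => absurd h hd1)
  have hcrossS : w.count 0 = 1 → w.count 1 = 0 → ∀ c, 2 ≤ c →
      ∑ r ∈ Finset.Icc 1 (2 * g), form g (eStar g r) (letterVec 0 0 σ c) •
        tens 8 (w.map (letterVec (e g r) (eStar g r) σ)) =
      -tens 8 ((w.map (replaceLetter 0 c)).map (letterVec (0 : H g) 0 σ)) := fun h h' c hc => by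
    rw [sum_form_eStar_tens σ hn.le h h' _ 0, List.map_map]
    congr 2
    refine List.map_congr_left fun d _ => ?_
    simp only [Function.comp_apply, replaceLetter_eq]
    split_ifs with hd1
    · subst hd1; rw [hzero]
    · exact letterVec_congr (fun h => absurd h hd1) (fun _ => rfl)
  have hcard : ∀ t : ⨂[ℚ]^8 (H g), ∑ _r ∈ Finset.Icc 1 (2 * g), t = ((2 * g : ℕ) : ℤ) • t :=
    fun t => by simp
  have hneg : ∀ (c : ℚ) (t : ⨂[ℚ]^8 (H g)), (-c) • t = -(c • t) := fun c t => neg_smul c t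
  have hz : ∀ t : ⨂[ℚ]^8 (H g), (-1 : ℤ) • t = -t := fun t => neg_one_zsmul t
  by_cases ha0 : a = 0
  · subst ha0
    by_cases hb1 : b = 1
    · subst hb1
      simp only [hzero, hone, hloop (by simpa using hc0) (by simpa using hc1)]
      rw [Finset.sum_congr rfl fun r hr => by rw [form_e_eStar hr, one_smul], hcard]
      simp [evalComb, -zsmul_eq_mul]
    · have hb0 : b ≠ 0 := by rintro rfl; simp at hc0
      have hb2 : 2 ≤ b := by omega
      simp only [hzero, hconst hb2]
      rw [hcrossE (by simpa [hb0] using hc0) (by simpa [hb1] using hc1) b hb2]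
      simp [evalComb, -zsmul_eq_mul, hb1]
  · by_cases ha1 : a = 1
    · subst ha1
      by_cases hb0 : b = 0
      · subst hb0
        simp only [hzero, hone, hloop (by simpa using hc0) (by simpa using hc1)]
        rw [Finset.sum_congr rfl fun r hr => by
          rw [form_swap, form_e_eStar hr, hneg, one_smul], hcard]
        simp [evalComb, hz, -zsmul_eq_mul]
      · have hb1 : b ≠ 1 := by rintro rfl; simp at hc1
        have hb2 : 2 ≤ b := by omega
        simp only [hone, hconst hb2]
        rw [hcrossS (by simpa [hb0] using hc0) (by simpa [hb1] using hc1) b hb2]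
        simp [evalComb, hz, -zsmul_eq_mul, hb0]
    · have ha2 : 2 ≤ a := by omega
      by_cases hb0 : b = 0
      · subst hb0
        simp only [hzero, hconst ha2]
        rw [Finset.sum_congr rfl fun r hr => by rw [form_swap, hneg], Finset.sum_neg_distrib,
          hcrossE (by simpa [ha0] using hc0) (by simpa [ha1] using hc1) a ha2]
        simp [evalComb, hz, -zsmul_eq_mul, ha0, ha1]
      · by_cases hb1 : b = 1
        · subst hb1
          simp only [hone, hconst ha2]
          rw [Finset.sum_congr rfl fun r hr => by rw [form_swap, hneg],
            Finset.sum_neg_distrib,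
            hcrossS (by simpa [ha0] using hc0) (by simpa [ha1] using hc1) a ha2]
          simp [evalComb, -zsmul_eq_mul, ha0, ha1]
        · have hb2 : 2 ≤ b := by omega
          rw [Finset.sum_eq_zero fun r _ => by rw [form_letterVec hg _ _ _ _ σ ha2 hb2, zero_smul]]
          simp [evalComb, -zsmul_eq_mul, ha0, ha1, hb0, hb1]

theorem evalComb_altWord (S : Finset (Equiv.Perm (Fin 6))) (n : ℕ) (x y : H g) (L : Comb) :
    evalComb (altWord S n x y) L = ∑ σ ∈ S, (Equiv.Perm.sign σ : ℤ) •
      evalComb (fun w => tens n (w.map (letterVec x y σ))) L := by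
  change evalComb (fun w => altWord S n x y w) L = _
  simp only [altWord]
  rw [evalComb_finset_sum]
  refine Finset.sum_congr rfl fun σ _ => ?_
  exact (map_evalComb (DistribSMul.toAddMonoidHom _ (Equiv.Perm.sign σ : ℤ)) _ L).symm

theorem Theta_hookWord (hg : 6 ≤ g) {l : ℕ} (h1 : 1 ≤ l) (h2 : l ≤ 9)
    (hl : l - 1 + (8 + 1 - l) = 8) {w : List ℕ} (hw : goodWord w = true) :
    Theta g 8 l h1 h2 (hookWord g w) =
      varpi g hl (((2 * g : ℕ) : ℤ) • evalComb (altWord Finset.univ 8 0 0) (loopPart l w) +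
        evalComb (altWord Finset.univ 8 0 0) (crossPart l w)) := by
  simp only [goodWord, Bool.and_eq_true, beq_iff_eq] at hw
  obtain ⟨⟨hlen, hw0⟩, hw1⟩ := hw
  obtain ⟨a, t, rfl⟩ : ∃ a t, w = a :: t := by
    cases w with
    | nil => simp at hlen
    | cons a t => exact ⟨a, t, rfl⟩
  have htl : t.length = 9 := by simpa using hlen
  obtain ⟨u, b, v, rfl, hu⟩ : ∃ u b v, t = u ++ b :: v ∧ u.length = l - 1 :=
    ⟨t.take (l - 1), t[l - 1], t.drop (l - 1 + 1), by simp, by simp; omega⟩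
  have hn : (u ++ v).length = 8 := by
    simp only [List.length_append, List.length_cons] at htl ⊢
    omega
  have hσ : ∀ σ : Equiv.Perm (Fin 6), ∑ r ∈ Finset.Icc 1 (2 * g), Theta g 8 l h1 h2
      (tens 10 ((a :: (u ++ b :: v)).map (letterVec (e g r) (eStar g r) σ))) =
      varpi g hl (((2 * g : ℕ) : ℤ) • evalComb (fun w => tens 8 (w.map (letterVec (0 : H g) 0 σ)))
        (loopPart l (a :: (u ++ b :: v))) +
      evalComb (fun w => tens 8 (w.map (letterVec (0 : H g) 0 σ)))
        (crossPart l (a :: (u ++ b :: v)))) := fun σ => by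
    rw [← sum_form_letterVec hg σ hu h1 hn hw0 hw1, map_sum]
    refine Finset.sum_congr rfl fun r _ => ?_
    rw [List.map_cons, List.map_append, List.map_cons, Theta_tens h1 h2 hl _ _ (by simpa using hu),
      map_smul, List.map_append]
  simp only [hookWord, altWord, map_sum, map_zsmul]
  rw [Finset.sum_comm]
  simp only [← Finset.smul_sum, hσ]
  rw [evalComb_altWord, evalComb_altWord, Finset.smul_sum, ← Finset.sum_add_distrib, map_sum]
  refine Finset.sum_congr rfl fun σ _ => ?_
  rw [← map_zsmul, smul_add, smul_comm]

theorem varpi_tens {k p q : ℕ} (h : p + q = k) {A B : List (H g)} (hA : A.length = p)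
    (hB : B.length = q) :
    varpi g h (tens k (A ++ B)) = proj g p (tens p A) ⊗ₜ[ℚ] proj g q (tens q B) := by
  subst hA hB
  rw [tens, varpi_tprod]
  congr 3
  · ext1 t
    simp [List.getElem?_append_left]
  · ext1 t
    simp

theorem proj_rotate {n : ℕ} {A : List (H g)} (hA : A.length = n) {i : ℕ} (hi : i ≤ n) :
    proj g n (tens n (A.drop i ++ A.take i)) = proj g n (tens n A) := by
  have h1 : ∀ x, proj g n (place g n (finRotate n) x) = proj g n x := fun x => by
    have : proj g n ∘ₗ place g n (finRotate n) = proj g n := by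
      refine PiTensorProduct.ext (MultilinearMap.ext fun a => ?_)
      simp only [LinearMap.compMultilinearMap_apply, LinearMap.comp_apply, place_tprod]
      exact ((Submodule.Quotient.eq (cyclicRel g n)).2
        (Submodule.subset_span (Set.mem_range_self a))).symm
    exact LinearMap.congr_fun this x
  have h2 : ∀ i x, proj g n (place g n (finRotate n ^ i) x) = proj g n x := fun i x => by
    induction i with
    | zero => rw [pow_zero, ← act_of, map_one, act_one]
    | succ i ih => rw [pow_succ, place_mul_apply, h1, ih]
  rw [← List.rotate_eq_drop_append_take (by omega), ← place_finRotate_pow_tens i A hA, h2]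

/-- All the rotated words have the same image in the cyclic coinvariants, so summing over them
multiplies by their number. -/
theorem evalComb_rotations (S : Finset (Equiv.Perm (Fin 6))) {l : ℕ}
    (hl : l - 1 + (8 + 1 - l) = 8) {w : List ℕ} (hw : w.length = 8) :
    evalComb (fun w => varpi g hl (altWord S 8 0 0 w)) (rotations l w) =
      ((l - 1) * (9 - l)) • varpi g hl (altWord S 8 0 0 w) := by
  have h : ∀ i ≤ l - 1, ∀ j ≤ 9 - l, varpi g hl (altWord S 8 0 0
      ((w.take (l - 1)).drop i ++ (w.take (l - 1)).take i ++
        ((w.drop (l - 1)).drop j ++ (w.drop (l - 1)).take j))) =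
      varpi g hl (altWord S 8 0 0 w) := fun i hi j hj => by
    simp only [altWord, map_sum, map_zsmul]
    refine Finset.sum_congr rfl fun σ _ => ?_
    congr 1
    have hA : ((w.take (l - 1)).map (letterVec (0 : H g) 0 σ)).length = l - 1 := by
      simp; omega
    have hB : ((w.drop (l - 1)).map (letterVec (0 : H g) 0 σ)).length = 8 + 1 - l := by
      simp; omega
    conv_rhs => rw [← List.take_append_drop (l - 1) w, List.map_append, varpi_tens hl hA hB]
    rw [List.map_append, List.map_append, List.map_append, List.map_drop (i := i),
      List.map_take (i := i), List.map_drop (i := j), List.map_take (i := j),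
      varpi_tens hl (by simp; omega) (by simp; omega), proj_rotate hA hi, proj_rotate hB hj]
  have h' : ∀ p ∈ rotations l w, varpi g hl (altWord S 8 0 0 p.2) =
      varpi g hl (altWord S 8 0 0 w) ∧ p.1 = 1 := fun p hp => by
    simp only [rotations, List.mem_flatMap, List.mem_map, List.mem_range] at hp
    obtain ⟨i, hi, j, hj, rfl⟩ := hp
    exact ⟨h i hi.le j hj.le, rfl⟩
  have hlen : (rotations l w).length = (l - 1) * (9 - l) := by
    simp [rotations, List.length_flatMap]
  rw [evalComb, List.map_congr_left (g := fun _ => varpi g hl (altWord S 8 0 0 w))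
    fun p hp => by rw [(h' p hp).1, (h' p hp).2, one_smul]]
  simp [hlen]

theorem length_of_mem_bindComb {n : ℕ} {L : Comb} {F : List ℕ → Comb}
    (hF : ∀ p ∈ L, ∀ q ∈ F p.2, q.2.length = n) : ∀ p ∈ bindComb L F, p.2.length = n := by
  intro p hp
  simp only [bindComb, smulComb, List.mem_flatMap, List.mem_map] at hp
  obtain ⟨q, hq, r, hr, rfl⟩ := hp
  exact hF q hq r hr

/-- For 2 ≤ ℓ ≤ 8 the number of rotations is nonzero and can be cancelled over ℚ. Vanishing in the
coinvariants thus follows from cancellation among the rotated words. -/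
theorem evalComb_eq_zero_of_rotations {S : Finset (Equiv.Perm (Fin 6))} {l a : ℕ} (h2 : 2 ≤ l)
    (h8 : l ≤ 8) (hl : l - 1 + (8 + 1 - l) = 8) {L : Comb}
    (hS : Antisymmetric (altWord S 8 (0 : H g) 0) a) (hL : ∀ p ∈ L, p.2.length = 8)
    (h : (normalize a (bindComb L (rotations l))).isEmpty = true) :
    varpi g hl (evalComb (altWord S 8 0 0) L) = 0 := by
  have hf := map_evalComb (varpi g hl).toAddMonoidHom (altWord S 8 0 0) L
  simp only [LinearMap.toAddMonoidHom_coe] at hf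
  have h1 : evalComb (fun w => varpi g hl (altWord S 8 0 0 w)) (bindComb L (rotations l)) = 0 := by
    have hA : Antisymmetric (fun w => varpi g hl (altWord S 8 0 0 w)) a :=
      hS.map (varpi g hl).toAddMonoidHom
    rw [← evalComb_normalize hA, List.isEmpty_iff.1 h]
    rfl
  rw [evalComb_bindComb, evalComb_congr (f' := fun w => ((l - 1) * (9 - l)) •
    varpi g hl (altWord S 8 0 0 w)) fun p hp => evalComb_rotations S hl (hL p hp)] at h1
  have h3 := map_evalComb (DistribSMul.toAddMonoidHom _ ((l - 1) * (9 - l)))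
    (fun w => varpi g hl (altWord S 8 0 0 w)) L
  simp only [DistribSMul.toAddMonoidHom_apply] at h3
  rw [hf]
  rw [← h3] at h1
  have hne : (((l - 1) * (9 - l) : ℕ) : ℚ) ≠ 0 := by
    have : 0 < (l - 1) * (9 - l) := Nat.mul_pos (by omega) (by omega)
    exact_mod_cast this.ne'
  rw [← Nat.cast_smul_eq_nsmul ℚ] at h1
  exact (smul_eq_zero.1 h1).resolve_left hne

theorem zetaComb_goodWord : ∀ p ∈ zetaComb, goodWord p.2 = true :=
  List.all_eq_true.1 zetaComb_good

theorem length_loopPart {l : ℕ} (h1 : 1 ≤ l) (h2 : l ≤ 9) {w : List ℕ} (hw : w.length = 10) :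
    ∀ q ∈ loopPart l w, q.2.length = 8 := by
  cases w with
  | nil => simp at hw
  | cons a t =>
    have ht : t.length = 9 := by simpa using hw
    intro q hq
    simp only [loopPart] at hq
    split_ifs at hq <;> simp at hq <;> subst hq <;> simp <;> omega

theorem length_crossPart {l : ℕ} (h1 : 1 ≤ l) (h2 : l ≤ 9) {w : List ℕ} (hw : w.length = 10) :
    ∀ q ∈ crossPart l w, q.2.length = 8 := by
  cases w with
  | nil => simp at hw
  | cons a t =>
    have ht : t.length = 9 := by simpa using hw
    intro q hq
    simp only [crossPart] at hq
    split_ifs at hq <;> simp at hq <;> subst hq <;> simp <;> omega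

theorem Theta_vThetaZeta (hg : 6 ≤ g) (l : ℕ) (h2 : 2 ≤ l) (h8 : l ≤ 8) :
    Theta g 8 l (le_trans one_le_two h2) (le_trans h8 (Nat.le_succ 8)) (vThetaZeta g) = 0 := by
  have hl : l - 1 + (8 + 1 - l) = 8 := by omega
  have hlen : ∀ p ∈ zetaComb, p.2.length = 10 := fun p hp => by
    have := zetaComb_goodWord p hp
    simp only [goodWord, Bool.and_eq_true, beq_iff_eq] at this
    exact this.1.1
  have hloop : ∀ p ∈ normalize 2 (bindComb zetaComb (loopPart l)), p.2.length = 8 :=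
    length_normalize (length_of_mem_bindComb fun p hp =>
      length_loopPart (by omega) (by omega) (hlen p hp))
  have hcross : ∀ p ∈ normalize 2 (bindComb zetaComb (crossPart l)), p.2.length = 8 :=
    length_normalize (length_of_mem_bindComb fun p hp =>
      length_crossPart (by omega) (by omega) (hlen p hp))
  have hexp : ∀ p ∈ bindComb (normalize 2 (bindComb zetaComb (loopPart l))) expandWord,
      p.2.length = 8 := length_of_mem_bindComb fun p hp q hq => by
    simp only [expandWord, List.mem_cons, List.mem_map, List.mem_range] at hq
    rcases hq with rfl | ⟨t, _, rfl⟩ <;> simpa using hloop p hp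
  have h1 := evalComb_eq_zero_of_rotations h2 h8 hl (altWord_stabPerm_antisymmetric (g := g) 8 0 0)
    hexp (loopPart_vanishes l h2 h8)
  -- The expansion over the stabilizer is folded back, so that both parts are expressed by the full
  -- antisymmetrization.
  have hE : ∀ L, evalComb (fun w => evalComb (altWord stabPerm 8 (0 : H g) 0) (expandWord w)) L =
      evalComb (altWord Finset.univ 8 0 0) L := fun L =>
    evalComb_congr fun p _ => (altWord_univ_eq 8 0 0 p.2).symm
  rw [evalComb_bindComb, hE, evalComb_normalize (altWord_univ_antisymmetric 8 0 0),
    evalComb_bindComb] at h1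
  have h3 := evalComb_eq_zero_of_rotations h2 h8 hl (altWord_univ_antisymmetric (g := g) 8 0 0)
    hcross (crossPart_vanishes l h2 h8)
  rw [evalComb_normalize (altWord_univ_antisymmetric 8 0 0), evalComb_bindComb] at h3
  have h := map_evalComb (Theta g 8 l (le_trans one_le_two h2)
    (le_trans h8 (Nat.le_succ 8))).toAddMonoidHom (hookWord g) zetaComb
  simp only [LinearMap.toAddMonoidHom_coe] at h
  rw [← evalComb_zetaComb, h,
    evalComb_congr (f' := fun w => varpi g hl (((2 * g : ℕ) : ℤ) •
      evalComb (altWord Finset.univ 8 0 0) (loopPart l w) +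
        evalComb (altWord Finset.univ 8 0 0) (crossPart l w)))
      fun p hp => Theta_hookWord hg _ _ hl (zetaComb_goodWord p hp)]
  have h4 := map_evalComb (varpi g hl).toAddMonoidHom
  simp only [LinearMap.toAddMonoidHom_coe] at h4
  rw [← h4]
  have h5 : ∀ f f' : List ℕ → ⨂[ℚ]^8 (H g), ∀ L : Comb, evalComb (fun w => f w + f' w) L =
      evalComb f L + evalComb f' L := fun f f' L => by
    simp [evalComb, List.sum_map_add]
  have h6 := map_evalComb (DistribSMul.toAddMonoidHom (⨂[ℚ]^8 (H g)) ((2 * g : ℕ) : ℤ))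
  simp only [DistribSMul.toAddMonoidHom_apply] at h6
  rw [h5, ← h6, map_add, map_zsmul, h1, h3, smul_zero, add_zero]

end ThetaWords

/-! ## The vector does not vanish -/

section Nonvanishing

variable {g : ℕ}

/-- The contraction `a_0 ⊗ a_1 ⊗ ⋯ ⊗ a_n ↦ ⟨a_0, y⟩ a_1 ⊗ ⋯ ⊗ a_n`. -/
def contractFirst (n : ℕ) (y : H g) : ⨂[ℚ]^(n + 1) (H g) →ₗ[ℚ] ⨂[ℚ]^n (H g) :=
  PiTensorProduct.lift
    (LinearMap.uncurryLeft (M := fun _ : Fin (n + 1) => H g)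
      (((form g).flip y).smulRight (PiTensorProduct.tprod ℚ)))

theorem contractFirst_tens (n : ℕ) (y a : H g) (l : List (H g)) :
    contractFirst n y (tens (n + 1) (a :: l)) = form g a y • tens n l := by
  rw [tens, contractFirst, PiTensorProduct.lift.tprod]
  simp only [LinearMap.uncurryLeft_apply, LinearMap.smulRight_apply, smul_apply]
  rfl

/-- The words that arise when the first letter is contracted with a vector denoted by `0`. -/
def leadPart : List ℕ → Comb
  | [] => []
  | a :: t => if a = 0 then [(1, t.map (replaceLetter 1 0))] else if a = 1 then [(-1, t)] else []

/-- Pairing with e_6 kills every word that starts with one of e_1, …, e_6, by isotropy. If it starts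
with a factor of ω, the other factor becomes ±e_6, and the sum over r disappears. -/
theorem contractFirst_hookWord (hg : 6 ≤ g) {w : List ℕ} (hw : goodWord w = true) :
    contractFirst 9 (e g 6) (hookWord g w) =
      evalComb (altWord Finset.univ 9 (e g 6) 0) (leadPart w) := by
  simp only [goodWord, Bool.and_eq_true, beq_iff_eq] at hw
  obtain ⟨⟨hlen, hw0⟩, hw1⟩ := hw
  obtain ⟨a, t, rfl⟩ : ∃ a t, w = a :: t := by
    cases w with
    | nil => simp at hlen
    | cons a t => exact ⟨a, t, rfl⟩
  have htl : t.length ≤ 9 := by simp only [List.length_cons] at hlen; omega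
  simp only [hookWord, altWord, map_sum, map_zsmul, List.map_cons, contractFirst_tens]
  rw [Finset.sum_comm, evalComb_altWord]
  refine Finset.sum_congr rfl fun σ _ => ?_
  rw [← Finset.smul_sum]
  congr 1
  have hz : ∀ t : ⨂[ℚ]^9 (H g), (-1 : ℤ) • t = -t := fun t => neg_one_zsmul t
  have hone : ∀ t : ⨂[ℚ]^9 (H g), (1 : ℤ) • t = t := fun t => one_zsmul t
  by_cases ha0 : a = 0
  · subst ha0
    have h0 : t.count 0 = 0 := by simpa using hw0
    have h1 : t.count 1 = 1 := by simpa using hw1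
    simp only [leadPart, if_true, evalComb_cons, evalComb_nil, add_zero, hone]
    have hv : ∀ r, letterVec (e g r) (eStar g r) σ 0 = e g r := fun r => by simp [letterVec]
    simp only [hv]
    rw [sum_form_e_tens σ htl h0 h1 0, List.map_map]
    congr 1
    refine List.map_congr_left fun d hd => ?_
    have hd0 : d ≠ 0 := by rintro rfl; exact absurd hd (List.count_eq_zero.1 h0)
    simp only [Function.comp_apply, replaceLetter_eq]
    split_ifs with hd1
    · simp [hd1, letterVec]
    · exact letterVec_congr (fun h => absurd h hd0) (fun h => absurd h hd1)
  · by_cases ha1 : a = 1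
    · subst ha1
      have h0 : t.count 0 = 1 := by simpa using hw0
      have h1 : t.count 1 = 0 := by simpa using hw1
      have hv : ∀ r, letterVec (e g r) (eStar g r) σ 1 = eStar g r := fun r => by simp [letterVec]
      simp only [leadPart, if_neg ha0, if_true, evalComb_cons, evalComb_nil, add_zero, hz, hv]
      rw [sum_form_eStar_tens σ htl h0 h1 (e g 6) 0]
    · simp only [leadPart, if_neg ha0, if_neg ha1, evalComb_nil]
      refine Finset.sum_eq_zero fun r _ => ?_
      obtain ⟨b, h1, h2, h3⟩ := exists_letterVec_eq (e g r) (eStar g r) σ (c := a) (by omega)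
      rw [h3, form_e_e h1 (by omega) hg, zero_smul]

/-- The coordinate function `a_1 ⊗ ⋯ ⊗ a_n ↦ ∏ a_i(T_i)`. -/
def coord {n : ℕ} (T : Fin n → Fin (2 * g)) : ⨂[ℚ]^n (H g) →ₗ[ℚ] ℚ :=
  PiTensorProduct.lift
    ((MultilinearMap.mkPiAlgebra ℚ (Fin n) ℚ).compLinearMap fun i => LinearMap.proj (T i))

theorem coord_tens {n : ℕ} (T : Fin n → Fin (2 * g)) (l : List (H g)) :
    coord T (tens n l) = ∏ i : Fin n, l.getD i 0 (T i) := by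
  rw [tens, coord, PiTensorProduct.lift.tprod]
  simp

/-- The index, counted from zero, of the basis vector denoted by a letter, when `0` denotes `e_6`
and `1` denotes the zero vector. -/
def letterIdx (σ : Equiv.Perm (Fin 6)) (c : ℕ) : ℕ :=
  -- The value 6 lies beyond the coordinates tested, which are below 6, so it matches none of them,
  -- as the zero vector requires.
  if c = 0 then 5 else if c = 1 then 6 else if h : c - 2 < 6 then σ ⟨c - 2, h⟩ else 0

theorem letterVec_apply (σ : Equiv.Perm (Fin 6)) (c : ℕ) {t : Fin (2 * g)} (ht : t.val < 6) :
    letterVec (e g 6) 0 σ c t = if letterIdx σ c = t.val then 1 else 0 := by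
  simp only [letterVec, letterIdx]
  split_ifs <;> simp_all [e] <;> omega

/-- The coordinates that detect the word `0 8 8 2 3 4 5 6 7`. -/
def detectIdx : Fin 9 → ℕ := ![5, 0, 0, 0, 1, 2, 3, 4, 5]

theorem coord_altWord {T : Fin 9 → Fin (2 * g)} (hT : ∀ i, (T i).val = detectIdx i) {w : List ℕ}
    (hw : w.length = 9) :
    coord T (altWord Finset.univ 9 (e g 6) 0 w) = ∑ σ : Equiv.Perm (Fin 6),
      if ∀ i : Fin 9, letterIdx σ (w.getD i 0) = detectIdx i then
        ((Equiv.Perm.sign σ : ℤ) : ℚ) else 0 := by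
  rw [altWord, map_sum]
  refine Finset.sum_congr rfl fun σ _ => ?_
  have h6 : ∀ i, detectIdx i < 6 := by decide
  have h : ∀ i : Fin 9, (w.map (letterVec (e g 6) 0 σ)).getD i 0 (T i) =
      if letterIdx σ (w.getD i 0) = detectIdx i then 1 else 0 := fun i => by
    have hi : i.val < w.length := by omega
    rw [← hT, ← letterVec_apply σ _ (by rw [hT]; exact h6 i)]
    simp [hi]
  rw [map_zsmul, coord_tens, Finset.prod_congr rfl fun i _ => h i, Fintype.prod_boole]
  split_ifs <;> simp

/-- A word whose letters `0` and `8` are compatible with the detecting coordinates. -/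
def fits (w : List ℕ) : Bool :=
  (List.finRange 9).all fun i =>
    (w.getD i 0 != 0 || detectIdx i == 5) && (w.getD i 0 != 8 || detectIdx i == 0)

/-- The letters 0 and 8 denote e_6 and e_1 for every σ, so a mismatch at one of them kills all terms
at once. -/
theorem coord_altWord_eq_zero {T : Fin 9 → Fin (2 * g)} (hT : ∀ i, (T i).val = detectIdx i)
    {w : List ℕ} (hw : w.length = 9) (h : fits w = false) :
    coord T (altWord Finset.univ 9 (e g 6) 0 w) = 0 := by
  rw [coord_altWord hT hw]
  refine Finset.sum_eq_zero fun σ _ => if_neg fun hσ => ?_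
  rw [fits, List.all_eq_false] at h
  obtain ⟨i, -, hi⟩ := h
  have := hσ i
  refine hi ?_
  simp only [Bool.and_eq_true, Bool.or_eq_true, bne_iff_ne, beq_iff_eq, ← this]
  by_cases hc0 : w.getD i 0 = 0
  · exact ⟨Or.inr (by rw [hc0]; rfl), Or.inl (by rw [hc0]; decide)⟩
  by_cases hc8 : w.getD i 0 = 8
  · exact ⟨Or.inl hc0, Or.inr (by rw [hc8]; rfl)⟩
  exact ⟨Or.inl hc0, Or.inl hc8⟩

/-- In the last six places the letters 2, …, 7 meet the coordinates 0, …, 5 in order, which forces σ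
= 1. -/
theorem coord_altWord_eq_one {T : Fin 9 → Fin (2 * g)} (hT : ∀ i, (T i).val = detectIdx i) :
    coord T (altWord Finset.univ 9 (e g 6) 0 [0, 8, 8, 2, 3, 4, 5, 6, 7]) = 1 := by
  rw [coord_altWord hT rfl, Finset.sum_eq_single 1]
  · rw [if_pos (by decide)]
    simp
  · intro σ _ hσ
    refine if_neg fun h => hσ ?_
    have hword : ∀ c : Fin 6, [0, 8, 8, 2, 3, 4, 5, 6, 7].getD (c.val + 3) 0 = c.val + 2 := by
      decide
    have hidx : ∀ c : Fin 6, detectIdx ⟨c + 3, by omega⟩ = c := by decide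
    have h' : ∀ c : Fin 6, σ c = c := fun c => by
      have hc := h ⟨c + 3, by omega⟩
      rw [hidx] at hc
      change letterIdx σ ([0, 8, 8, 2, 3, 4, 5, 6, 7].getD (c.val + 3) 0) = c at hc
      rw [hword] at hc
      rw [letterIdx, if_neg (by omega), if_neg (by omega), dif_pos (by omega)] at hc
      exact Fin.ext hc
    exact Equiv.ext h'
  · simp

theorem length_leadPart {w : List ℕ} (hw : goodWord w = true) :
    ∀ q ∈ leadPart w, q.2.length = 9 := by
  cases w with
  | nil => simp [goodWord] at hw
  | cons a t =>
    have ht : t.length = 9 := by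
      simp only [goodWord, Bool.and_eq_true, beq_iff_eq] at hw
      simpa using hw.1.1
    intro q hq
    simp only [leadPart] at hq
    split_ifs at hq <;> simp at hq <;> subst hq <;> simpa

theorem evalComb_filter {N : Type*} [AddCommGroup N] {f : List ℕ → N} {P : List ℕ → Bool}
    {L : Comb} (h : ∀ p ∈ L, P p.2 = false → f p.2 = 0) :
    evalComb f (L.filter fun p => P p.2) = evalComb f L := by
  induction L with
  | nil => rfl
  | cons p L ih =>
    have ih := ih fun q hq => h q (by simp [hq])
    rw [List.filter_cons]
    split_ifs with hp
    · rw [evalComb_cons, evalComb_cons, ih]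
    · rw [ih, evalComb_cons, h p (by simp) (by simpa using hp), smul_zero, zero_add]

/-- The decisive computation for nonvanishing: after collection, a single word, with coefficient 1,
can contribute to the chosen coordinate. -/
theorem filter_fits_leadPart : (normalize 2 (bindComb zetaComb leadPart)).filter
    (fun p => fits p.2) = [(1, [0, 8, 8, 2, 3, 4, 5, 6, 7])] := by
  decide +kernel

theorem vThetaZeta_ne_zero (hg : 6 ≤ g) : vThetaZeta g ≠ 0 := by
  intro h0
  have h6 : ∀ i, detectIdx i < 6 := by decide
  obtain ⟨T, hT⟩ : ∃ T : Fin 9 → Fin (2 * g), ∀ i, (T i).val = detectIdx i :=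
    ⟨fun i => ⟨detectIdx i, by have := h6 i; omega⟩, fun _ => rfl⟩
  have h1 := map_evalComb (contractFirst 9 (e g 6)).toAddMonoidHom (hookWord g) zetaComb
  simp only [LinearMap.toAddMonoidHom_coe] at h1
  rw [evalComb_zetaComb, h0, map_zero,
    evalComb_congr (f' := fun w => evalComb (altWord Finset.univ 9 (e g 6) 0) (leadPart w))
      fun p hp => contractFirst_hookWord hg (zetaComb_goodWord p hp), ← evalComb_bindComb,
    ← evalComb_normalize (altWord_univ_antisymmetric 9 (e g 6) 0)] at h1
  have hlen : ∀ p ∈ normalize 2 (bindComb zetaComb leadPart), p.2.length = 9 :=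
    length_normalize (length_of_mem_bindComb fun p hp =>
      length_leadPart (zetaComb_goodWord p hp))
  have hfits := filter_fits_leadPart
  generalize normalize 2 (bindComb zetaComb leadPart) = L at h1 hlen hfits
  have h2 := map_evalComb (coord T).toAddMonoidHom (altWord Finset.univ 9 (e g 6) 0) L
  simp only [LinearMap.toAddMonoidHom_coe] at h2
  have h3 := evalComb_filter (f := fun w => coord T (altWord Finset.univ 9 (e g 6) 0 w))
    (P := fits) (L := L) fun p hp h => coord_altWord_eq_zero hT (hlen p hp) h
  rw [hfits, evalComb_cons, evalComb_nil, ← h2, ← h1, map_zero] at h3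
  dsimp only at h3
  rw [coord_altWord_eq_one hT, one_smul, add_zero] at h3
  exact one_ne_zero h3

theorem ThetaSum_vThetaZeta (hg : 6 ≤ g) : ThetaSum g 8 (vThetaZeta g) = 0 := by
  rw [ThetaSum, LinearMap.sum_apply]
  refine Finset.sum_eq_zero fun l _ => ?_
  split_ifs with h
  · rw [LinearMap.comp_apply, Theta_vThetaZeta hg l h.1 h.2, map_zero]
  · rfl

end Nonvanishing

end JohnsonCokernel

end

theorem mainTheorem4 (g : ℕ) (hg : 6 ≤ g) :
    JohnsonCokernel.vThetaZeta g ∈ JohnsonCokernel.𝔥 g 8 ∧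
    JohnsonCokernel.IsSpMaximal g [3, 1, 1, 1, 1, 1] (JohnsonCokernel.vThetaZeta g) ∧
    (∀ (l : ℕ) (h2 : 2 ≤ l) (h8 : l ≤ 8),
      JohnsonCokernel.Theta g 8 l (le_trans one_le_two h2) (le_trans h8 (Nat.le_succ 8))
        (JohnsonCokernel.vThetaZeta g) = 0) ∧
    (∀ x ∈ JohnsonCokernel.𝔥 g 8,
      JohnsonCokernel.deltaAlg g 8 x = (10 : ℚ) • JohnsonCokernel.ThetaSum g 8 x) ∧
    JohnsonCokernel.deltaAlg g 8 (JohnsonCokernel.vThetaZeta g) = 0 := by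
  have hmem := JohnsonCokernel.vThetaZeta_mem g
  have hdelta : ∀ x ∈ JohnsonCokernel.𝔥 g 8,
      JohnsonCokernel.deltaAlg g 8 x = (10 : ℚ) • JohnsonCokernel.ThetaSum g 8 x :=
    fun x hx => JohnsonCokernel.deltaAlg_eq_of_invariant (JohnsonCokernel.rotate_eq_of_mem hx)
  refine ⟨hmem, JohnsonCokernel.isSpMaximal_vThetaZeta hg (JohnsonCokernel.vThetaZeta_ne_zero hg),
    fun l h2 h8 => JohnsonCokernel.Theta_vThetaZeta hg l h2 h8, hdelta, ?_⟩
  rw [hdelta _ hmem, JohnsonCokernel.ThetaSum_vThetaZeta hg, smul_zero]
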